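/- A \emph{closed framed curve} is a pair $(\gamma,V)$ in which $\gamma:\mathbb{R}/2\mathbb{Z}\to\mathbb{R}^3$ is a smooth immersion and $V:\mathbb{R}/2\mathbb{Z}\to\mathbb{R}^3$ is a smooth unit vector field with $\langle \gamma',V\rangle=0$. Write $\mathrm{d}s=\|\gamma'\|\,\mathrm{d}t$, $D_s=\|\gamma'\|^{-1}\frac{d}{dt}$, $$\kappa=\|D_s^2\gamma\|,\qquad \mathrm{tw}=\langle D_sV, D_s\gamma\times V\rangle,\qquad \mathrm{st}=\frac{1}{\|\gamma'\|}D_s\|\gamma'\|,$$ and define the generalized Kirchhoff energy $$\mathrm{E}(\gamma,V)=\int_0^2\left(\kappa^2+\mathrm{tw}^2+\mathrm{st}^2\right)\|\gamma'\|^2\,\mathrm{d}s .$$ For $\ell>0$ let $\mathcal{M}$ be the space of closed framed curves with $\mathrm{length}(\gamma)=\ell$ modulo translations, rotations (the group $\mathrm{SO}(3)$) and global frame twists (rotation of $V$ by one constant angle in the planes normal to $\gamma$); fixing the length $\ell$ realizes the quotient by scaling. Since $\mathrm{E}$ is invariant under these actions it induces $\mathrm{E}_{\mathcal{M}}:\mathcal{M}\to\mathbb{R}$.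 A point $m\in\mathcal{M}$ is \emph{critical} if $\frac{d}{d\varepsilon}\big|_{\varepsilon=0}\mathrm{E}_{\mathcal M}([\gamma_\varepsilon,V_\varepsilon])=0$ for every smooth one-parameter family $(\gamma_\varepsilon,V_\varepsilon)$ of closed framed curves of length $\ell$ with $[\gamma_0,V_0]=m$, and the values of $\mathrm{E}_{\mathcal M}$ at its critical points are its critical energy levels. \textbf{Statement.} For every $\ell>0$, the set of critical energy levels of $\mathrm{E}_{\mathcal{M}}$ is exactly $$\left\{\ \ell\cdot\frac{\pi^2(c^2+d^2)}{2}\ :\ c,d\in\mathbb{Z},\ c\equiv d \ (\mathrm{mod}\ 2),\ (c,d)\neq(0,0)\right\}.$$ In particular, with the normalization $\ell=2$ the critical energy levels are $\pi^2(c^2+d^2)$. -/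

import Mathlib

open scoped ContDiff InnerProductSpace

noncomputable section

namespace FramedCurve

/-- Euclidean three-space. -/
abbrev E3 : Type := EuclideanSpace ℝ (Fin 3)

/-- The standard cross product on Euclidean three-space. -/
def cross (a b : E3) : E3 :=
  WithLp.toLp 2 (crossProduct (WithLp.ofLp a) (WithLp.ofLp b))

/-- The derivative with respect to arclength along `γ`: `D_s f = f' / ‖γ'‖`. -/
def arcDeriv {F : Type*} [NormedAddCommGroup F] [NormedSpace ℝ F]
    (γ : ℝ → E3) (f : ℝ → F) (t : ℝ) : F :=
  ‖deriv γ t‖⁻¹ • deriv f t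

/-- The unit tangent `D_s γ`. -/
def unitTangent (γ : ℝ → E3) : ℝ → E3 := arcDeriv γ γ

/-- The curvature `κ = ‖D_s² γ‖`. -/
def curvature (γ : ℝ → E3) (t : ℝ) : ℝ := ‖arcDeriv γ (arcDeriv γ γ) t‖

/-- The twist rate `tw = ⟨D_s V, D_s γ × V⟩`. -/
def twistRate (γ V : ℝ → E3) (t : ℝ) : ℝ :=
  ⟪arcDeriv γ V t, cross (arcDeriv γ γ t) (V t)⟫_ℝ

/-- The relative stretch rate `st = (1 / ‖γ'‖) D_s ‖γ'‖`. -/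
def stretchRate (γ : ℝ → E3) (t : ℝ) : ℝ :=
  ‖deriv γ t‖⁻¹ * arcDeriv γ (fun s => ‖deriv γ s‖) t

/-- The length of `γ` over the parameter interval `[0, 2]`. -/
def length (γ : ℝ → E3) : ℝ := ∫ t in (0 : ℝ)..2, ‖deriv γ t‖

/-- The generalized Kirchhoff energy
`E(γ, V) = ∫ (κ² + tw² + st²) ‖γ'‖² ds`, with `ds = ‖γ'‖ dt`, over `[0, 2]`. -/
def energy (γ V : ℝ → E3) : ℝ :=
  ∫ t in (0 : ℝ)..2,
    ((curvature γ t ^ 2 + twistRate γ V t ^ 2 + stretchRate γ t ^ 2) * ‖deriv γ t‖ ^ 2)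
      * ‖deriv γ t‖

/-- A smoothly closed framed curve of length `ℓ`, parameterized by the circle `ℝ / 2ℤ`: an
immersed smooth loop together with a smooth unit normal vector field along it. -/
structure FramedLoop (ℓ : ℝ) where
  curve : ℝ → E3
  frame : ℝ → E3
  smooth_curve : ContDiff ℝ ∞ curve
  smooth_frame : ContDiff ℝ ∞ frame
  periodic_curve : Function.Periodic curve 2
  periodic_frame : Function.Periodic frame 2
  immersed : ∀ t, deriv curve t ≠ 0
  unit_frame : ∀ t, ‖frame t‖ = 1
  normal_frame : ∀ t, ⟪deriv curve t, frame t⟫_ℝ = 0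
  length_eq : length curve = ℓ

/-- The rotation of a vector field `V` along `γ` by the constant angle `θ` in the planes normal
to `γ`. -/
def twistFrame (θ : ℝ) (γ V : ℝ → E3) (t : ℝ) : E3 :=
  Real.cos θ • V t + Real.sin θ • cross (unitTangent γ t) (V t)

/-- Two framed loops are congruent if they differ by a translation, a rotation and a global frame
twist. -/
def Congruent {ℓ : ℝ} (x y : FramedLoop ℓ) : Prop :=
  ∃ (R : E3 ≃ₗᵢ[ℝ] E3) (b : E3) (θ : ℝ),
    LinearMap.det (R.toLinearEquiv : E3 →ₗ[ℝ] E3) = 1 ∧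
    (∀ t, y.curve t = R (x.curve t) + b) ∧
    (∀ t, y.frame t = R (twistFrame θ x.curve x.frame t))

/-! ### The energy is invariant under congruence -/

theorem inner_cross_eq_det (a b c : E3) :
    ⟪cross a b, c⟫_ℝ = (EuclideanSpace.basisFun (Fin 3) ℝ).toBasis.det ![a, b, c] := by
  rw [Module.Basis.det_apply, Matrix.det_fin_three]
  simp [cross, crossProduct, PiLp.inner_apply, Fin.sum_univ_three, Module.Basis.toMatrix_apply]
  ring

theorem map_cross (R : E3 ≃ₗᵢ[ℝ] E3)
    (hR : LinearMap.det (R.toLinearEquiv : E3 →ₗ[ℝ] E3) = 1) (a b : E3) :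
    R (cross a b) = cross (R a) (R b) := by
  refine ext_inner_right ℝ fun v => ?_
  obtain ⟨c, rfl⟩ := R.surjective v
  rw [R.inner_map_map, inner_cross_eq_det, inner_cross_eq_det]
  have h := (EuclideanSpace.basisFun (Fin 3) ℝ).toBasis.det_comp
    (R.toLinearEquiv : E3 →ₗ[ℝ] E3) ![a, b, c]
  rw [hR, one_mul] at h
  rw [← h]
  congr 1
  ext i : 1
  fin_cases i <;> rfl

theorem cross_add_smul_right (a b c : E3) (r s : ℝ) :
    cross a (r • b + s • c) = r • cross a b + s • cross a c := by
  simp [cross]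

theorem inner_cross_left (a b : E3) : ⟪a, cross a b⟫_ℝ = 0 := by
  simp [cross, crossProduct, PiLp.inner_apply, Fin.sum_univ_three]
  ring

theorem inner_cross_right (a b : E3) : ⟪b, cross a b⟫_ℝ = 0 := by
  simp [cross, crossProduct, PiLp.inner_apply, Fin.sum_univ_three]
  ring

theorem cross_cross_eq (a b : E3) :
    cross a (cross a b) = ⟪a, b⟫_ℝ • a - ⟪a, a⟫_ℝ • b := by
  ext i
  fin_cases i <;>
    simp [cross, crossProduct, PiLp.inner_apply, Fin.sum_univ_three,
      -inner_self_eq_norm_sq_to_K] <;> ring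

theorem inner_cross_cross (a b : E3) :
    ⟪cross a b, cross a b⟫_ℝ = ⟪a, a⟫_ℝ * ⟪b, b⟫_ℝ - ⟪a, b⟫_ℝ ^ 2 := by
  simp only [cross, crossProduct, PiLp.inner_apply, Fin.sum_univ_three]
  simp
  ring

namespace FramedLoop

variable {ℓ : ℝ}

theorem unitTangent_inner_self (x : FramedLoop ℓ) (t : ℝ) :
    ⟪unitTangent x.curve t, unitTangent x.curve t⟫_ℝ = 1 := by
  have h : ‖deriv x.curve t‖ ≠ 0 := norm_ne_zero_iff.2 (x.immersed t)
  rw [unitTangent, arcDeriv, real_inner_smul_left, real_inner_smul_right,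
    real_inner_self_eq_norm_sq]
  field_simp

theorem unitTangent_inner_frame (x : FramedLoop ℓ) (t : ℝ) :
    ⟪unitTangent x.curve t, x.frame t⟫_ℝ = 0 := by
  rw [unitTangent, arcDeriv, real_inner_smul_left, x.normal_frame, mul_zero]

theorem frame_inner_self (x : FramedLoop ℓ) (t : ℝ) : ⟪x.frame t, x.frame t⟫_ℝ = 1 := by
  rw [real_inner_self_eq_norm_sq, x.unit_frame, one_pow]

/-- The third vector of the adapted orthonormal frame. -/
def binormal (x : FramedLoop ℓ) (t : ℝ) : E3 := cross (unitTangent x.curve t) (x.frame t)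

theorem binormal_inner_self (x : FramedLoop ℓ) (t : ℝ) :
    ⟪x.binormal t, x.binormal t⟫_ℝ = 1 := by
  rw [binormal, inner_cross_cross, x.unitTangent_inner_self, x.frame_inner_self,
    x.unitTangent_inner_frame]
  norm_num

theorem frame_inner_binormal (x : FramedLoop ℓ) (t : ℝ) :
    ⟪x.frame t, x.binormal t⟫_ℝ = 0 := inner_cross_right _ _

theorem cross_unitTangent_binormal (x : FramedLoop ℓ) (t : ℝ) :
    cross (unitTangent x.curve t) (x.binormal t) = -x.frame t := by
  rw [binormal, cross_cross_eq, x.unitTangent_inner_self, x.unitTangent_inner_frame]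
  simp

theorem cross_unitTangent_twistFrame (x : FramedLoop ℓ) (θ t : ℝ) :
    cross (unitTangent x.curve t) (twistFrame θ x.curve x.frame t)
      = Real.cos θ • x.binormal t - Real.sin θ • x.frame t := by
  have h := x.cross_unitTangent_binormal t
  rw [twistFrame, cross_add_smul_right]
  change _ + Real.sin θ • cross _ (x.binormal t) = _
  rw [h, smul_neg, ← sub_eq_add_neg]
  rfl

theorem differentiable_frame (x : FramedLoop ℓ) : Differentiable ℝ x.frame :=
  x.smooth_frame.differentiable (by simp)

theorem smooth_deriv (x : FramedLoop ℓ) : ContDiff ℝ ∞ (deriv x.curve) :=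
  (contDiff_infty_iff_deriv.1 x.smooth_curve).2

theorem smooth_unitTangent (x : FramedLoop ℓ) : ContDiff ℝ ∞ (unitTangent x.curve) :=
  ((x.smooth_deriv.norm ℝ x.immersed).inv
    fun t => norm_ne_zero_iff.2 (x.immersed t)).smul x.smooth_deriv

theorem smooth_binormal (x : FramedLoop ℓ) : ContDiff ℝ ∞ x.binormal := by
  have hT := contDiff_euclidean.1 x.smooth_unitTangent
  have hV := contDiff_euclidean.1 x.smooth_frame
  refine contDiff_euclidean.2 fun i => ?_
  fin_cases i
  · simpa [binormal, cross, crossProduct] using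
      ((hT 1).mul (hV 2)).sub ((hT 2).mul (hV 1))
  · simpa [binormal, cross, crossProduct] using
      ((hT 2).mul (hV 0)).sub ((hT 0).mul (hV 2))
  · simpa [binormal, cross, crossProduct] using
      ((hT 0).mul (hV 1)).sub ((hT 1).mul (hV 0))

theorem differentiable_binormal (x : FramedLoop ℓ) : Differentiable ℝ x.binormal :=
  x.smooth_binormal.differentiable (by simp)

end FramedLoop

theorem inner_deriv_add_of_const {f g : ℝ → E3} (hf : Differentiable ℝ f)
    (hg : Differentiable ℝ g) {k : ℝ} (h : ∀ t, ⟪f t, g t⟫_ℝ = k) (t : ℝ) :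
    ⟪deriv f t, g t⟫_ℝ + ⟪f t, deriv g t⟫_ℝ = 0 := by
  have h1 := (hf t).hasDerivAt.inner ℝ (hg t).hasDerivAt
  have h2 : (fun t => ⟪f t, g t⟫_ℝ) = fun _ => k := funext h
  rw [h2] at h1
  have h3 := h1.unique (hasDerivAt_const t k)
  linarith

theorem deriv_map (R : E3 ≃ₗᵢ[ℝ] E3) (f : ℝ → E3) (b : E3) (t : ℝ) :
    deriv (fun s => R (f s) + b) t = R (deriv f t) := by
  rw [deriv_add_const]
  by_cases hf : DifferentiableAt ℝ f t
  · exact ((R.toContinuousLinearEquiv : E3 →L[ℝ] E3).hasFDerivAt.comp_hasDerivAt t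
      hf.hasDerivAt).deriv
  · rw [deriv_zero_of_not_differentiableAt hf, map_zero]
    refine deriv_zero_of_not_differentiableAt fun h => hf ?_
    have h' := (R.symm.toContinuousLinearEquiv : E3 →L[ℝ] E3).differentiableAt.comp t h
    simpa [Function.comp_def] using h'

theorem deriv_map' (R : E3 ≃ₗᵢ[ℝ] E3) (f : ℝ → E3) (t : ℝ) :
    deriv (fun s => R (f s)) t = R (deriv f t) := by
  simpa using deriv_map R f 0 t

theorem arcDeriv_map (R : E3 ≃ₗᵢ[ℝ] E3) (γ f : ℝ → E3) (b : E3) (t : ℝ) :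
    arcDeriv (fun s => R (γ s) + b) (fun s => R (f s)) t = R (arcDeriv γ f t) := by
  rw [arcDeriv, arcDeriv, deriv_map, deriv_map', R.norm_map, map_smul]

theorem unitTangent_map (R : E3 ≃ₗᵢ[ℝ] E3) (γ : ℝ → E3) (b : E3) (t : ℝ) :
    unitTangent (fun s => R (γ s) + b) t = R (unitTangent γ t) := by
  rw [unitTangent, unitTangent, arcDeriv, arcDeriv, deriv_map, R.norm_map, map_smul]

theorem curvature_map (R : E3 ≃ₗᵢ[ℝ] E3) (γ : ℝ → E3) (b : E3) (t : ℝ) :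
    curvature (fun s => R (γ s) + b) t = curvature γ t := by
  have h : arcDeriv (fun s => R (γ s) + b) (fun s => R (γ s) + b)
      = fun s => R (arcDeriv γ γ s) := funext (unitTangent_map R γ b)
  rw [curvature, curvature, h, arcDeriv_map, R.norm_map]

theorem stretchRate_map (R : E3 ≃ₗᵢ[ℝ] E3) (γ : ℝ → E3) (b : E3) (t : ℝ) :
    stretchRate (fun s => R (γ s) + b) t = stretchRate γ t := by
  simp only [stretchRate, arcDeriv, deriv_map, R.norm_map]

theorem twistRate_map (R : E3 ≃ₗᵢ[ℝ] E3)
    (hR : LinearMap.det (R.toLinearEquiv : E3 →ₗ[ℝ] E3) = 1) (γ V : ℝ → E3) (b : E3) (t : ℝ) :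
    twistRate (fun s => R (γ s) + b) (fun s => R (V s)) t = twistRate γ V t := by
  have h := unitTangent_map R γ b t
  rw [unitTangent, unitTangent] at h
  rw [twistRate, twistRate, arcDeriv_map, h, ← map_cross R hR, R.inner_map_map]

theorem twistRate_twistFrame {ℓ : ℝ} (x : FramedLoop ℓ) (θ t : ℝ) :
    twistRate x.curve (twistFrame θ x.curve x.frame) t = twistRate x.curve x.frame t := by
  have hV := x.differentiable_frame
  have hW := x.differentiable_binormal
  have hd : deriv (twistFrame θ x.curve x.frame) t
      = Real.cos θ • deriv x.frame t + Real.sin θ • deriv x.binormal t :=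
    (((hV t).hasDerivAt.const_smul (Real.cos θ)).add
      ((hW t).hasDerivAt.const_smul (Real.sin θ))).deriv
  have h1 := inner_deriv_add_of_const hV hV x.frame_inner_self t
  have h2 := inner_deriv_add_of_const hW hW x.binormal_inner_self t
  have h3 := inner_deriv_add_of_const hV hW x.frame_inner_binormal t
  have h4 := x.cross_unitTangent_twistFrame θ t
  have h5 := Real.sin_sq_add_cos_sq θ
  rw [real_inner_comm (deriv x.frame t)] at h1
  rw [real_inner_comm (deriv x.binormal t)] at h2
  rw [real_inner_comm (deriv x.binormal t)] at h3
  have h1' : ⟪deriv x.frame t, x.frame t⟫_ℝ = 0 := by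
    linarith
  have h2' : ⟪deriv x.binormal t, x.binormal t⟫_ℝ = 0 := by
    linarith
  change ⟪arcDeriv x.curve _ t, cross (unitTangent x.curve t) _⟫_ℝ
    = ⟪arcDeriv x.curve x.frame t, x.binormal t⟫_ℝ
  rw [arcDeriv, arcDeriv, hd, h4]
  simp only [inner_sub_right, inner_add_left, real_inner_smul_left, real_inner_smul_right]
  rw [h1', h2']
  linear_combination
    (-(‖deriv x.curve t‖⁻¹ * Real.sin θ ^ 2)) * h3
      + ‖deriv x.curve t‖⁻¹ * ⟪deriv x.frame t, x.binormal t⟫_ℝ * h5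

theorem Congruent.energy_eq {ℓ : ℝ} {x y : FramedLoop ℓ} (h : Congruent x y) :
    energy x.curve x.frame = energy y.curve y.frame := by
  obtain ⟨R, b, θ, hR, hc, hf⟩ := h
  have hc' : y.curve = fun s => R (x.curve s) + b := funext hc
  have hf' : y.frame = fun s => R (twistFrame θ x.curve x.frame s) := funext hf
  rw [hc', hf']
  simp only [energy, curvature_map, stretchRate_map, twistRate_map R hR, deriv_map, R.norm_map,
    twistRate_twistFrame]

/-! ### Congruence is an equivalence relation -/

theorem Congruent.refl {ℓ : ℝ} (x : FramedLoop ℓ) : Congruent x x := by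
  refine ⟨LinearIsometryEquiv.refl ℝ E3, 0, 0, ?_, ?_, ?_⟩
  · exact LinearMap.det_id
  · simp
  · simp [twistFrame]

theorem twistFrame_map (R : E3 ≃ₗᵢ[ℝ] E3)
    (hR : LinearMap.det (R.toLinearEquiv : E3 →ₗ[ℝ] E3) = 1) (γ V : ℝ → E3) (b : E3) (θ t : ℝ) :
    twistFrame θ (fun s => R (γ s) + b) (fun s => R (V s)) t = R (twistFrame θ γ V t) := by
  rw [twistFrame, twistFrame, unitTangent_map, ← map_cross R hR, map_add, map_smul, map_smul]

theorem twistFrame_twistFrame {ℓ : ℝ} (x : FramedLoop ℓ) (θ φ t : ℝ) :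
    twistFrame φ x.curve (twistFrame θ x.curve x.frame) t
      = twistFrame (φ + θ) x.curve x.frame t := by
  have h : twistFrame φ x.curve (twistFrame θ x.curve x.frame) t
      = Real.cos φ • twistFrame θ x.curve x.frame t
        + Real.sin φ • cross (unitTangent x.curve t) (twistFrame θ x.curve x.frame t) := rfl
  rw [h, x.cross_unitTangent_twistFrame]
  change Real.cos φ • (Real.cos θ • x.frame t + Real.sin θ • x.binormal t) + _
    = Real.cos (φ + θ) • x.frame t + Real.sin (φ + θ) • x.binormal t
  rw [Real.cos_add, Real.sin_add]
  module

theorem Congruent.symm {ℓ : ℝ} {x y : FramedLoop ℓ} (h : Congruent x y) : Congruent y x := by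
  obtain ⟨R, b, θ, hR, hc, hf⟩ := h
  have hc' : y.curve = fun s => R (x.curve s) + b := funext hc
  have hf' : y.frame = fun s => R (twistFrame θ x.curve x.frame s) := funext hf
  refine ⟨R.symm, -R.symm b, -θ, ?_, fun t => ?_, fun t => ?_⟩
  · have h1 := LinearEquiv.det_mul_det_symm R.toLinearEquiv
    rw [hR, one_mul] at h1
    exact h1
  · rw [hc t]; simp
  · rw [hf', hc', twistFrame_map R hR, R.symm_apply_apply, twistFrame_twistFrame]
    simp [twistFrame]

theorem Congruent.trans {ℓ : ℝ} {x y z : FramedLoop ℓ} (h : Congruent x y)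
    (h' : Congruent y z) : Congruent x z := by
  obtain ⟨R, b, θ, hR, hc, hf⟩ := h
  obtain ⟨S, c, φ, hS, hc2, hf2⟩ := h'
  have hc' : y.curve = fun s => R (x.curve s) + b := funext hc
  have hf' : y.frame = fun s => R (twistFrame θ x.curve x.frame s) := funext hf
  refine ⟨R.trans S, S b + c, φ + θ, ?_, fun t => ?_, fun t => ?_⟩
  · have h1 : ((R.trans S).toLinearEquiv : E3 →ₗ[ℝ] E3)
        = (S.toLinearEquiv : E3 →ₗ[ℝ] E3) * (R.toLinearEquiv : E3 →ₗ[ℝ] E3) := rfl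
    rw [h1, map_mul, hR, hS, one_mul]
  · rw [hc2, hc]; simp [add_assoc]
  · rw [hf2, hf', hc', twistFrame_map R hR, twistFrame_twistFrame]
    rfl

/-- Framed loops of length `ℓ` up to translation, rotation and global frame twisting. -/
def congruenceSetoid (ℓ : ℝ) : Setoid (FramedLoop ℓ) where
  r := Congruent
  iseqv := ⟨Congruent.refl, Congruent.symm, Congruent.trans⟩

/-- The moduli space of framed loops. The quotient by scaling is realized by fixing the
length `ℓ`. -/
def Moduli (ℓ : ℝ) : Type := Quotient (congruenceSetoid ℓ)

/-- The class of a framed loop in the moduli space. -/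
def FramedLoop.toModuli {ℓ : ℝ} (x : FramedLoop ℓ) : Moduli ℓ :=
  Quotient.mk (congruenceSetoid ℓ) x

/-- The functional induced by the generalized Kirchhoff energy on the moduli space. -/
def moduliEnergy {ℓ : ℝ} (m : Moduli ℓ) : ℝ :=
  Quotient.lift (s := congruenceSetoid ℓ) (fun x : FramedLoop ℓ => energy x.curve x.frame)
    (fun _ _ h => Congruent.energy_eq h) m

/-- A smooth one-parameter family of framed loops of length `ℓ`. -/
def IsSmoothFamily {ℓ : ℝ} (F : ℝ → FramedLoop ℓ) : Prop :=
  ContDiff ℝ ∞ (fun p : ℝ × ℝ => (F p.1).curve p.2) ∧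
  ContDiff ℝ ∞ (fun p : ℝ × ℝ => (F p.1).frame p.2)

/-- A point of the moduli space is critical for the induced energy if the energy has derivative
zero along every smooth path in the moduli space (the projection of a smooth family of framed
loops of length `ℓ`) through the point. -/
def IsCriticalPoint {ℓ : ℝ} (m : Moduli ℓ) : Prop :=
  ∀ F : ℝ → FramedLoop ℓ, IsSmoothFamily F → (F 0).toModuli = m →
    HasDerivAt (fun ε : ℝ => moduliEnergy (F ε).toModuli) 0 0

/-- The set of critical energy levels, that is, the values of the induced energy at its critical
points. -/
def criticalEnergyLevels (ℓ : ℝ) : Set ℝ :=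
  {e | ∃ m : Moduli ℓ, IsCriticalPoint m ∧ moduliEnergy m = e}

end FramedCurve

end

/-!
Lift the orthogonal frame `γ', V, γ' × V` of a framed curve through the Hopf map
`(a, b) ↦ (|a|² - |b|², 2 a̅ b)`. The lift is a pair of sections of one of the two flat complex line
bundles over the circle, the curve closes up if and only if the two sections are `L²`-orthogonal of
equal norm, and the Kirchhoff energy becomes four times the Dirichlet energy of the pair, which is
the trace of a quadratic form on the plane spanned by the two sections.

At a critical point this plane is stable under `-d²/dt²`. The Dirichlet energy is therefore
`ℓ / 2` times the sum of two eigenvalues of `-d²/dt²` on the same line bundle, which are of the form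
`(π c / 2)²` with the parity of `c` determined by the bundle.

Conversely, two distinct Fourier modes of the same parity induce a uniformly twisted, possibly
multiply covered circle. Such a framed curve is critical because the first variation of its energy
density is a constant multiple of the variation of `‖γ'‖`, whose integral vanishes as the length is
fixed, plus a total derivative.
-/

noncomputable section

namespace FramedCurve

/-! ### Smooth functions of two real variables -/

section TwoVariables

variable {F : Type*} [NormedAddCommGroup F] [NormedSpace ℝ F] {u : ℝ × ℝ → F}

/-- The partial derivative in the first variable, which labels the curves of a family. -/
def partialFst (u : ℝ × ℝ → F) (p : ℝ × ℝ) : F := fderiv ℝ u p (1, 0)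

/-- The partial derivative in the second variable, which parameterizes each curve of a family. -/
def partialSnd (u : ℝ × ℝ → F) (p : ℝ × ℝ) : F := fderiv ℝ u p (0, 1)

theorem contDiff_partialFst (hu : ContDiff ℝ ∞ u) : ContDiff ℝ ∞ (partialFst u) :=
  (hu.fderiv_right (m := ∞) (by simp)).clm_apply contDiff_const

theorem contDiff_partialSnd (hu : ContDiff ℝ ∞ u) : ContDiff ℝ ∞ (partialSnd u) :=
  (hu.fderiv_right (m := ∞) (by simp)).clm_apply contDiff_const

theorem hasDerivAt_partialFst (hu : Differentiable ℝ u) (e t : ℝ) :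
    HasDerivAt (fun e => u (e, t)) (partialFst u (e, t)) e :=
  (hu (e, t)).hasFDerivAt.comp_hasDerivAt e ((hasDerivAt_id e).prodMk (hasDerivAt_const e t))

theorem hasDerivAt_partialSnd (hu : Differentiable ℝ u) (e t : ℝ) :
    HasDerivAt (fun t => u (e, t)) (partialSnd u (e, t)) t :=
  (hu (e, t)).hasFDerivAt.comp_hasDerivAt t ((hasDerivAt_const t e).prodMk (hasDerivAt_id t))

theorem partialFst_partialSnd (hu : ContDiff ℝ ∞ u) (p : ℝ × ℝ) :
    partialFst (partialSnd u) p = partialSnd (partialFst u) p := by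
  have hd : DifferentiableAt ℝ (fderiv ℝ u) p :=
    (hu.fderiv_right (m := ∞) (by simp)).differentiable (by simp) p
  have h : IsSymmSndFDerivAt ℝ u p := hu.contDiffAt.isSymmSndFDerivAt <| by
    rw [minSmoothness_of_isRCLikeNormedField]
    exact WithTop.coe_le_coe.2 (le_top : (2 : ℕ∞) ≤ ⊤)
  have fderiv_apply (v w : ℝ × ℝ) :
      fderiv ℝ (fun q => fderiv ℝ u q v) p w = fderiv ℝ (fderiv ℝ u) p w v := by
    simp [fderiv_clm_apply hd (differentiableAt_const v)]
  exact (fderiv_apply _ _).trans ((h _ _).trans (fderiv_apply _ _).symm)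

theorem periodic_fderiv {E : Type*} [NormedAddCommGroup E] [NormedSpace ℝ E] {f : E → F} {c : E}
    (hf : Function.Periodic f c) : Function.Periodic (fderiv ℝ f) c := fun p => by
  rw [← fderiv_comp_add_right, hf.funext]

theorem periodic_partialFst {c : ℝ × ℝ} (hu : Function.Periodic u c) :
    Function.Periodic (partialFst u) c := fun p => by
  rw [partialFst, partialFst, periodic_fderiv hu]

theorem periodic_partialSnd {c : ℝ × ℝ} (hu : Function.Periodic u c) :
    Function.Periodic (partialSnd u) c := fun p => by
  rw [partialSnd, partialSnd, periodic_fderiv hu]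

theorem integral_partialSnd_eq_zero [CompleteSpace F] (hu : ContDiff ℝ ∞ u) {T : ℝ}
    (hp : Function.Periodic u (0, T)) (e : ℝ) :
    ∫ t in (0 : ℝ)..T, partialSnd u (e, t) = 0 := by
  have hc : Continuous fun t => partialSnd u (e, t) :=
    (contDiff_partialSnd hu).continuous.comp (by fun_prop)
  have h : u (e, T) = u (e, 0) := by simpa using hp (e, 0)
  rw [intervalIntegral.integral_eq_sub_of_hasDerivAt
    (fun t _ => hasDerivAt_partialSnd (hu.differentiable (by simp)) e t)
    (hc.intervalIntegrable _ _), h, sub_self]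

end TwoVariables

theorem inner_fderiv_add_of_const {E G : Type*} [NormedAddCommGroup E] [NormedSpace ℝ E]
    [NormedAddCommGroup G] [InnerProductSpace ℝ G] {f g : E → G} (hf : Differentiable ℝ f)
    (hg : Differentiable ℝ g) {c : ℝ} (h : ∀ p, ⟪f p, g p⟫_ℝ = c) (p v : E) :
    ⟪fderiv ℝ f p v, g p⟫_ℝ + ⟪f p, fderiv ℝ g p v⟫_ℝ = 0 := by
  have h1 := fderiv_inner_apply ℝ (hf p) (hg p) v
  rw [funext h, fderiv_fun_const] at h1
  rw [add_comm, ← h1]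
  rfl

theorem inner_fderiv_self_of_const {E G : Type*} [NormedAddCommGroup E] [NormedSpace ℝ E]
    [NormedAddCommGroup G] [InnerProductSpace ℝ G] {f : E → G} (hf : Differentiable ℝ f)
    {c : ℝ} (h : ∀ p, ⟪f p, f p⟫_ℝ = c) (p v : E) : ⟪fderiv ℝ f p v, f p⟫_ℝ = 0 := by
  have h1 := inner_fderiv_add_of_const hf hf h p v
  rw [real_inner_comm (fderiv ℝ f p v)] at h1
  linarith

section Inner

variable {E : Type*} [NormedAddCommGroup E] [InnerProductSpace ℝ E] {f g : ℝ × ℝ → E}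

theorem partialFst_inner (hf : Differentiable ℝ f) (hg : Differentiable ℝ g) (p : ℝ × ℝ) :
    partialFst (fun q => ⟪f q, g q⟫_ℝ) p = ⟪f p, partialFst g p⟫_ℝ + ⟪partialFst f p, g p⟫_ℝ :=
  fderiv_inner_apply ℝ (hf p) (hg p) (1, 0)

theorem partialSnd_inner (hf : Differentiable ℝ f) (hg : Differentiable ℝ g) (p : ℝ × ℝ) :
    partialSnd (fun q => ⟪f q, g q⟫_ℝ) p = ⟪f p, partialSnd g p⟫_ℝ + ⟪partialSnd f p, g p⟫_ℝ :=
  fderiv_inner_apply ℝ (hf p) (hg p) (0, 1)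

theorem partialFst_inner_partialSnd_self (hf : ContDiff ℝ ∞ f) (p : ℝ × ℝ) :
    partialFst (fun q => ⟪partialSnd f q, partialSnd f q⟫_ℝ) p
      = 2 * (partialSnd (fun q => ⟪partialSnd f q, partialFst f q⟫_ℝ) p
        - ⟪partialSnd (partialSnd f) p, partialFst f p⟫_ℝ) := by
  have hfst := (contDiff_partialFst hf).differentiable (by simp)
  have hsnd := (contDiff_partialSnd hf).differentiable (by simp)
  rw [partialFst_inner hsnd hsnd, partialSnd_inner hsnd hfst, partialFst_partialSnd hf,
    real_inner_comm (partialSnd f p)]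
  ring

end Inner

/-! ### Integrals depending on a parameter -/

section ParametricIntegral

universe w

theorem hasFDerivAt_integral_of_contDiff {E F : Type*} [NormedAddCommGroup E] [NormedSpace ℝ E]
    [ProperSpace E] [NormedAddCommGroup F] [NormedSpace ℝ F] {f : E × ℝ → F}
    (hf : ContDiff ℝ 1 f) (a b : ℝ) (p : E) :
    HasFDerivAt (fun p => ∫ t in a..b, f (p, t))
      (∫ t in a..b, (fderiv ℝ f (p, t)).comp (.inl ℝ E ℝ)) p := by
  have hc := hf.continuous
  have hc' : Continuous fun q => (fderiv ℝ f q).comp (.inl ℝ E ℝ) :=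
    (hf.continuous_fderiv (by simp)).clm_comp continuous_const
  obtain ⟨C, hC⟩ := ((isCompact_closedBall p 1).prod (isCompact_uIcc (a := a) (b := b)))
    |>.exists_bound_of_continuousOn hc'.continuousOn
  refine intervalIntegral.hasFDerivAt_integral_of_dominated_of_fderiv_le
    (F := fun p t => f (p, t)) (F' := fun p t => (fderiv ℝ f (p, t)).comp (.inl ℝ E ℝ))
    (bound := fun _ => C) (Metric.ball_mem_nhds p one_pos) ?_ ?_ ?_ ?_ ?_ ?_
  · exact Filter.Eventually.of_forall fun x =>
      (by fun_prop : Continuous fun t => f (x, t)).aestronglyMeasurable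
  · exact (by fun_prop : Continuous fun t => f (p, t)).intervalIntegrable _ _
  · exact (hc'.comp (by fun_prop : Continuous fun t => (p, t))).aestronglyMeasurable
  · exact Filter.Eventually.of_forall fun t ht x hx =>
      hC (x, t) ⟨Metric.ball_subset_closedBall hx, Set.uIoc_subset_uIcc ht⟩
  · exact intervalIntegrable_const
  · exact Filter.Eventually.of_forall fun t _ x _ =>
      ((hf.differentiable (by simp)) (x, t)).hasFDerivAt.comp x (hasFDerivAt_prodMk_left x t)

theorem contDiff_integral {E : Type w} [NormedAddCommGroup E] [NormedSpace ℝ E] [ProperSpace E]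
    (a b : ℝ) (n : ℕ) : ∀ {F : Type w} [NormedAddCommGroup F] [NormedSpace ℝ F] {f : E × ℝ → F},
    ContDiff ℝ n f → ContDiff ℝ n fun p => ∫ t in a..b, f (p, t) := by
  induction n with
  | zero =>
    intro F _ _ f hf
    have hc := hf.continuous
    exact contDiff_zero.2 (intervalIntegral.continuous_parametric_intervalIntegral_of_continuous'
      (f := fun p t => f (p, t)) (by fun_prop) a b)
  | succ n ih =>
    intro F _ _ f hf
    have hD := hasFDerivAt_integral_of_contDiff (hf.of_le (by simp)) a b
    have hf' : ContDiff ℝ n fun q => (fderiv ℝ f q).comp (.inl ℝ E ℝ) :=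
      (hf.fderiv_right (by simp)).clm_comp contDiff_const
    push_cast
    rw [contDiff_succ_iff_fderiv, funext fun p => (hD p).fderiv]
    exact ⟨fun p => (hD p).differentiableAt, by simp, ih hf'⟩

theorem hasDerivAt_integral_of_contDiff {F : Type*} [NormedAddCommGroup F] [NormedSpace ℝ F]
    {f : ℝ × ℝ → F} (hf : ContDiff ℝ 1 f) (a b e : ℝ) :
    HasDerivAt (fun e => ∫ t in a..b, f (e, t)) (∫ t in a..b, partialFst f (e, t)) e := by
  have hc : Continuous fun t => (fderiv ℝ f (e, t)).comp (.inl ℝ ℝ ℝ) :=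
    ((hf.continuous_fderiv (by simp)).comp (by fun_prop)).clm_comp continuous_const
  have h := (hasFDerivAt_integral_of_contDiff hf a b e).hasDerivAt
  rwa [ContinuousLinearMap.intervalIntegral_apply (hc.intervalIntegrable _ _)] at h

theorem contDiff_parametric_primitive {F : Type} [NormedAddCommGroup F] [NormedSpace ℝ F]
    {f : ℝ × ℝ → F} (hf : ContDiff ℝ ∞ f) :
    ContDiff ℝ ∞ fun p : ℝ × ℝ => ∫ s in (0 : ℝ)..p.2, f (p.1, s) := by
  have h (p : ℝ × ℝ) :
      ∫ s in (0 : ℝ)..p.2, f (p.1, s) = p.2 • ∫ v in (0 : ℝ)..1, f (p.1, p.2 * v) := by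
    simp [intervalIntegral.smul_integral_comp_mul_left fun s => f (p.1, s)]
  rw [funext h]
  refine contDiff_snd.smul (contDiff_infty.2 fun n => ?_)
  have hf' : ContDiff ℝ ∞ fun q : (ℝ × ℝ) × ℝ => f (q.1.1, q.1.2 * q.2) :=
    hf.comp (contDiff_fst.fst.prodMk (contDiff_fst.snd.mul contDiff_snd))
  exact contDiff_integral 0 1 n (hf'.of_le (by exact_mod_cast le_top))

end ParametricIntegral

/-! ### Adapted orthonormal frames -/

theorem inner_eq_sum (p q : E3) : ⟪p, q⟫_ℝ = p 0 * q 0 + p 1 * q 1 + p 2 * q 2 := by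
  simp [PiLp.inner_apply, Fin.sum_univ_three]
  ring

theorem cross_apply_zero (p q : E3) : cross p q 0 = p 1 * q 2 - p 2 * q 1 := by
  simp [cross, crossProduct]

theorem cross_apply_one (p q : E3) : cross p q 1 = p 2 * q 0 - p 0 * q 2 := by
  simp [cross, crossProduct]

theorem cross_apply_two (p q : E3) : cross p q 2 = p 0 * q 1 - p 1 * q 0 := by
  simp [cross, crossProduct]

theorem cross_smul_smul (r s : ℝ) (p q : E3) : cross (r • p) (s • q) = (r * s) • cross p q := by
  simp [cross, smul_smul, mul_comm]

theorem contDiff_cross {G : Type*} [NormedAddCommGroup G] [NormedSpace ℝ G] {n : WithTop ℕ∞}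
    {f g : G → E3} (hf : ContDiff ℝ n f) (hg : ContDiff ℝ n g) :
    ContDiff ℝ n fun p => cross (f p) (g p) := by
  have hf' := contDiff_euclidean.1 hf
  have hg' := contDiff_euclidean.1 hg
  refine contDiff_euclidean.2 fun i => ?_
  fin_cases i
  · simpa [cross, crossProduct] using ((hf' 1).mul (hg' 2)).sub ((hf' 2).mul (hg' 1))
  · simpa [cross, crossProduct] using ((hf' 2).mul (hg' 0)).sub ((hf' 0).mul (hg' 2))
  · simpa [cross, crossProduct] using ((hf' 0).mul (hg' 1)).sub ((hf' 1).mul (hg' 0))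

theorem inner_cross_cross_eq (a b c d : E3) :
    ⟪cross a b, cross c d⟫_ℝ = ⟪a, c⟫_ℝ * ⟪b, d⟫_ℝ - ⟪a, d⟫_ℝ * ⟪b, c⟫_ℝ := by
  simp only [inner_eq_sum, cross_apply_zero, cross_apply_one, cross_apply_two]
  ring

theorem inner_cross_cyclic (a b c : E3) : ⟪cross a b, c⟫_ℝ = ⟪a, cross b c⟫_ℝ := by
  simp only [inner_eq_sum, cross_apply_zero, cross_apply_one, cross_apply_two]
  ring

theorem cross_cross_right (a b : E3) :
    cross b (cross a b) = ⟪b, b⟫_ℝ • a - ⟪a, b⟫_ℝ • b := by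
  ext i
  fin_cases i <;> simp [cross, crossProduct, PiLp.inner_apply, Fin.sum_univ_three,
    -inner_self_eq_norm_sq_to_K] <;> ring

theorem inner_eq_sum_frame {T V : E3} (hT : ⟪T, T⟫_ℝ = 1) (hV : ⟪V, V⟫_ℝ = 1)
    (hTV : ⟪T, V⟫_ℝ = 0) (p q : E3) :
    ⟪p, q⟫_ℝ = ⟪p, T⟫_ℝ * ⟪q, T⟫_ℝ + ⟪p, V⟫_ℝ * ⟪q, V⟫_ℝ
      + ⟪p, cross T V⟫_ℝ * ⟪q, cross T V⟫_ℝ := by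
  have hB : ⟪cross T V, cross T V⟫_ℝ = 1 := by
    rw [inner_cross_cross, hT, hV, hTV]
    norm_num
  have hTB := inner_cross_left T V
  have hVB := inner_cross_right T V
  have frame_orthonormal : Orthonormal ℝ ![T, V, cross T V] := by
    rw [orthonormal_iff_ite]
    intro i j
    fin_cases i <;> fin_cases j <;>
      simp [*, real_inner_comm, -inner_self_eq_norm_sq_to_K]
  let basis := (basisOfOrthonormalOfCardEqFinrank frame_orthonormal (by simp)).toOrthonormalBasis
    (by simpa using frame_orthonormal)
  rw [← basis.sum_inner_mul_inner p q, Fin.sum_univ_three]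
  simp [basis, real_inner_comm]

/-- The commutator identity behind the first variation of the total twist: `T₁, V₁, B₁` and
`T₂, V₂, B₂` are two infinitesimal variations of an orthonormal frame `T, V, T × V`. -/
theorem inner_variation_sub {T V T₁ V₁ B₁ T₂ V₂ B₂ : E3} (hT : ⟪T, T⟫_ℝ = 1)
    (hV : ⟪V, V⟫_ℝ = 1) (hTV : ⟪T, V⟫_ℝ = 0)
    (hV1 : ⟪V₁, V⟫_ℝ = 0) (hV2 : ⟪V₂, V⟫_ℝ = 0)
    (hB1 : ⟪B₁, cross T V⟫_ℝ = 0) (hB2 : ⟪B₂, cross T V⟫_ℝ = 0)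
    (hVT1 : ⟪V₁, T⟫_ℝ + ⟪V, T₁⟫_ℝ = 0) (hVT2 : ⟪V₂, T⟫_ℝ + ⟪V, T₂⟫_ℝ = 0)
    (hBT1 : ⟪B₁, T⟫_ℝ + ⟪cross T V, T₁⟫_ℝ = 0) (hBT2 : ⟪B₂, T⟫_ℝ + ⟪cross T V, T₂⟫_ℝ = 0) :
    ⟪V₂, B₁⟫_ℝ - ⟪V₁, B₂⟫_ℝ = ⟪cross T T₂, T₁⟫_ℝ := by
  have triple_product : ⟪cross T T₂, T₁⟫_ℝ
      = ⟪V, T₂⟫_ℝ * ⟪cross T V, T₁⟫_ℝ - ⟪V, T₁⟫_ℝ * ⟪cross T V, T₂⟫_ℝ := by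
    rw [inner_cross_cyclic, ← inner_cross_cross_eq, cross_cross_right, hV, hTV]
    simp
  rw [triple_product, inner_eq_sum_frame hT hV hTV V₂, inner_eq_sum_frame hT hV hTV V₁,
    hV1, hV2, hB1, hB2, eq_neg_of_add_eq_zero_left hVT1, eq_neg_of_add_eq_zero_left hVT2,
    eq_neg_of_add_eq_zero_left hBT1, eq_neg_of_add_eq_zero_left hBT2]
  ring

theorem deriv_periodic {G : Type*} [NormedAddCommGroup G] [NormedSpace ℝ G] {f : ℝ → G} {c : ℝ}
    (hf : Function.Periodic f c) : Function.Periodic (deriv f) c := fun t => by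
  rw [← deriv_comp_add_const, hf.funext]

namespace FramedLoop

variable {ℓ : ℝ}

/-- The speed `‖γ'‖` of the curve with respect to its parameter. -/
def speed (x : FramedLoop ℓ) (t : ℝ) : ℝ := ‖deriv x.curve t‖

/-- The twist `⟨V', T × V⟩` of the frame with respect to the parameter of the curve, which is
`‖γ'‖` times the twist rate. -/
def twist (x : FramedLoop ℓ) (t : ℝ) : ℝ := ⟪deriv x.frame t, x.binormal t⟫_ℝ

theorem speed_pos (x : FramedLoop ℓ) (t : ℝ) : 0 < x.speed t := norm_pos_iff.2 (x.immersed t)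

theorem deriv_curve_eq (x : FramedLoop ℓ) (t : ℝ) :
    deriv x.curve t = x.speed t • unitTangent x.curve t :=
  (smul_inv_smul₀ (x.speed_pos t).ne' _).symm

theorem twist_eq (x : FramedLoop ℓ) (t : ℝ) :
    x.twist t = x.speed t * twistRate x.curve x.frame t := by
  rw [twistRate, arcDeriv, real_inner_smul_left, ← speed, mul_inv_cancel_left₀ (x.speed_pos t).ne']
  rfl

theorem differentiable_unitTangent (x : FramedLoop ℓ) : Differentiable ℝ (unitTangent x.curve) :=
  x.smooth_unitTangent.differentiable (by simp)

theorem periodic_unitTangent (x : FramedLoop ℓ) :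
    Function.Periodic (unitTangent x.curve) 2 := fun t => by
  rw [unitTangent, arcDeriv, arcDeriv, deriv_periodic x.periodic_curve]

theorem periodic_binormal (x : FramedLoop ℓ) : Function.Periodic x.binormal 2 := fun t => by
  rw [binormal, binormal, x.periodic_unitTangent, x.periodic_frame]

theorem cross_frame_binormal (x : FramedLoop ℓ) (t : ℝ) :
    cross (x.frame t) (x.binormal t) = unitTangent x.curve t := by
  rw [binormal, cross_cross_right, x.frame_inner_self, x.unitTangent_inner_frame]
  simp

/-- The energy density with respect to the parameter of the curve. -/
def energyDensity (x : FramedLoop ℓ) (t : ℝ) : ℝ :=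
  x.speed t * ⟪deriv (unitTangent x.curve) t, deriv (unitTangent x.curve) t⟫_ℝ
    + x.speed t * x.twist t ^ 2 + deriv x.speed t ^ 2 / x.speed t

theorem energy_eq_integral (x : FramedLoop ℓ) :
    energy x.curve x.frame = ∫ t in (0 : ℝ)..2, x.energyDensity t := by
  refine intervalIntegral.integral_congr fun t _ => ?_
  have hr := (x.speed_pos t).ne'
  have curvature_sq : curvature x.curve t ^ 2 = (x.speed t)⁻¹ ^ 2 *
      ⟪deriv (unitTangent x.curve) t, deriv (unitTangent x.curve) t⟫_ℝ := by
    rw [curvature, arcDeriv, norm_smul, mul_pow, real_inner_self_eq_norm_sq, norm_inv, norm_norm]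
    rfl
  have stretchRate_eq : stretchRate x.curve t = (x.speed t)⁻¹ * ((x.speed t)⁻¹ * deriv x.speed t) :=
    rfl
  change (_ * x.speed t ^ 2) * x.speed t = _
  rw [energyDensity, curvature_sq, stretchRate_eq, twist_eq]
  field_simp

theorem unitTangent_inner_deriv (x : FramedLoop ℓ) (t : ℝ) :
    ⟪unitTangent x.curve t, deriv (unitTangent x.curve) t⟫_ℝ = 0 := by
  rw [real_inner_comm]
  exact inner_fderiv_self_of_const x.differentiable_unitTangent x.unitTangent_inner_self t 1

theorem differentiable_speed (x : FramedLoop ℓ) : Differentiable ℝ x.speed := fun t =>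
  (x.smooth_deriv.differentiable (by simp) t).norm ℝ (x.immersed t)

theorem speed_mul_energyDensity (x : FramedLoop ℓ) (t : ℝ) :
    x.speed t * x.energyDensity t
      = ⟪deriv (deriv x.curve) t, deriv (deriv x.curve) t⟫_ℝ + (x.speed t * x.twist t) ^ 2 := by
  have hr := (x.speed_pos t).ne'
  have deriv_curve : HasDerivAt (deriv x.curve)
      (x.speed t • deriv (unitTangent x.curve) t + deriv x.speed t • unitTangent x.curve t) t := by
    simp only [funext x.deriv_curve_eq]
    exact (x.differentiable_speed t).hasDerivAt.smul (x.differentiable_unitTangent t).hasDerivAt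
  rw [deriv_curve.deriv, energyDensity]
  simp only [inner_add_left, inner_add_right, real_inner_smul_left, real_inner_smul_right,
    x.unitTangent_inner_deriv, x.unitTangent_inner_self,
    real_inner_comm (unitTangent x.curve t) (deriv (unitTangent x.curve) t)]
  field_simp
  ring

end FramedLoop

/-! ### Uniformly twisted circles are critical -/

/-- A framed loop of constant speed whose unit tangent rotates uniformly, with angular velocity
`k` about a fixed axis, and whose frame twists at the constant rate `τ`, all with respect to the
parameter of the curve. -/
structure IsTwistedCircle {ℓ : ℝ} (x : FramedLoop ℓ) (k τ : ℝ) : Prop where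
  speed_eq : ∀ t, x.speed t = ℓ / 2
  deriv_deriv_tangent :
    ∀ t, deriv (deriv (unitTangent x.curve)) t = -(k ^ 2) • unitTangent x.curve t
  axis : ∃ e, ∀ t, cross (unitTangent x.curve t) (deriv (unitTangent x.curve) t) = e
  twist_eq : ∀ t, x.twist t = τ

namespace IsTwistedCircle

variable {ℓ k τ : ℝ} {x y : FramedLoop ℓ}

theorem congr (hx : IsTwistedCircle x k τ) (h : Congruent x y) : IsTwistedCircle y k τ := by
  obtain ⟨R, b, θ, hR, hc, hf⟩ := h
  have hc' : y.curve = fun s => R (x.curve s) + b := funext hc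
  have hf' : y.frame = fun s => R (twistFrame θ x.curve x.frame s) := funext hf
  have tangent_map : unitTangent y.curve = fun s => R (unitTangent x.curve s) := by
    rw [hc', funext (unitTangent_map R x.curve b)]
  have deriv_tangent_map :
      deriv (unitTangent y.curve) = fun s => R (deriv (unitTangent x.curve) s) := by
    rw [tangent_map, funext (deriv_map' R _)]
  have speed_map (t : ℝ) : y.speed t = x.speed t := by
    rw [FramedLoop.speed, hc', deriv_map, R.norm_map, FramedLoop.speed]
  refine ⟨fun t => (speed_map t).trans (hx.speed_eq t), fun t => ?_, ?_, fun t => ?_⟩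
  · rw [deriv_tangent_map, deriv_map', hx.deriv_deriv_tangent, tangent_map, map_smul]
  · obtain ⟨e, he⟩ := hx.axis
    exact ⟨R e, fun t => by rw [deriv_tangent_map, tangent_map, ← map_cross R hR, he]⟩
  · rw [← hx.twist_eq t, y.twist_eq, x.twist_eq, speed_map, hc', hf', twistRate_map R hR,
      twistRate_twistFrame]

theorem inner_deriv_tangent (hx : IsTwistedCircle x k τ) (t : ℝ) :
    ⟪deriv (unitTangent x.curve) t, deriv (unitTangent x.curve) t⟫_ℝ = k ^ 2 := by
  have hT' : Differentiable ℝ (deriv (unitTangent x.curve)) :=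
    (contDiff_infty_iff_deriv.1 x.smooth_unitTangent).2.differentiable (by simp)
  have h := inner_deriv_add_of_const x.differentiable_unitTangent hT' x.unitTangent_inner_deriv t
  rw [hx.deriv_deriv_tangent, real_inner_smul_right, x.unitTangent_inner_self] at h
  linarith

theorem energy_eq (hx : IsTwistedCircle x k τ) :
    energy x.curve x.frame = ℓ * (k ^ 2 + τ ^ 2) := by
  have speed_const : x.speed = fun _ => ℓ / 2 := funext hx.speed_eq
  rw [x.energy_eq_integral]
  simp only [FramedLoop.energyDensity, hx.inner_deriv_tangent, hx.twist_eq, speed_const,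
    deriv_const, intervalIntegral.integral_const, smul_eq_mul]
  ring

end IsTwistedCircle

theorem partialFst_inner_partialSnd_cross {T V : ℝ × ℝ → E3} (hT : ContDiff ℝ ∞ T)
    (hV : ContDiff ℝ ∞ V) (hTT : ∀ p, ⟪T p, T p⟫_ℝ = 1) (hVV : ∀ p, ⟪V p, V p⟫_ℝ = 1)
    (hTV : ∀ p, ⟪T p, V p⟫_ℝ = 0) (p : ℝ × ℝ) :
    partialFst (fun p => ⟪partialSnd V p, cross (T p) (V p)⟫_ℝ) p
      = partialSnd (fun p => ⟪partialFst V p, cross (T p) (V p)⟫_ℝ) p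
        + ⟪cross (T p) (partialSnd T p), partialFst T p⟫_ℝ := by
  have hB : ContDiff ℝ ∞ fun p => cross (T p) (V p) := contDiff_cross hT hV
  have dT := hT.differentiable (by simp)
  have dV := hV.differentiable (by simp)
  have dB := hB.differentiable (by simp)
  have hBB (p : ℝ × ℝ) : ⟪cross (T p) (V p), cross (T p) (V p)⟫_ℝ = 1 := by
    rw [inner_cross_cross, hTT, hVV, hTV]
    norm_num
  have hVT (p : ℝ × ℝ) : ⟪V p, T p⟫_ℝ = 0 := by rw [real_inner_comm, hTV]
  have hBT (p : ℝ × ℝ) : ⟪cross (T p) (V p), T p⟫_ℝ = 0 := by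
    rw [real_inner_comm, inner_cross_left]
  have commutator := inner_variation_sub (hTT p) (hVV p) (hTV p)
    (inner_fderiv_self_of_const dV hVV p (1, 0)) (inner_fderiv_self_of_const dV hVV p (0, 1))
    (inner_fderiv_self_of_const dB hBB p (1, 0)) (inner_fderiv_self_of_const dB hBB p (0, 1))
    (inner_fderiv_add_of_const dV dT hVT p (1, 0)) (inner_fderiv_add_of_const dV dT hVT p (0, 1))
    (inner_fderiv_add_of_const dB dT hBT p (1, 0)) (inner_fderiv_add_of_const dB dT hBT p (0, 1))
  rw [partialFst_inner ((contDiff_partialSnd hV).differentiable (by simp)) dB,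
    partialSnd_inner ((contDiff_partialFst hV).differentiable (by simp)) dB,
    partialFst_partialSnd hV]
  simp only [partialFst, partialSnd] at commutator ⊢
  linarith

section Family

variable {ℓ : ℝ} {F : ℝ → FramedLoop ℓ}

/-- A quantity `f` attached to framed loops, evaluated along a family of loops and regarded as a
function of the parameter of the family and of the parameter of the curve. -/
def alongFamily {G : Type*} (F : ℝ → FramedLoop ℓ) (f : FramedLoop ℓ → ℝ → G) (p : ℝ × ℝ) : G :=
  f (F p.1) p.2

theorem periodic_alongFamily {G : Type*} {f : FramedLoop ℓ → ℝ → G}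
    (hf : ∀ x, Function.Periodic (f x) 2) :
    Function.Periodic (alongFamily F f) (0, 2) := fun p => by
  simp [alongFamily, hf (F p.1) p.2]

theorem partialSnd_alongFamily {G : Type*} [NormedAddCommGroup G] [NormedSpace ℝ G]
    {f : FramedLoop ℓ → ℝ → G} (hf : ContDiff ℝ ∞ (alongFamily F f)) :
    partialSnd (alongFamily F f) = alongFamily F fun x => deriv (f x) :=
  funext fun p => (hasDerivAt_partialSnd (hf.differentiable (by simp)) p.1 p.2).deriv.symm

namespace IsSmoothFamily

theorem contDiff_curve (hF : IsSmoothFamily F) :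
    ContDiff ℝ ∞ (alongFamily F FramedLoop.curve) := hF.1

theorem contDiff_frame (hF : IsSmoothFamily F) :
    ContDiff ℝ ∞ (alongFamily F FramedLoop.frame) := hF.2

theorem contDiff_deriv_curve (hF : IsSmoothFamily F) :
    ContDiff ℝ ∞ (alongFamily F fun x => deriv x.curve) := by
  rw [← partialSnd_alongFamily hF.contDiff_curve]
  exact contDiff_partialSnd hF.contDiff_curve

theorem contDiff_speed (hF : IsSmoothFamily F) : ContDiff ℝ ∞ (alongFamily F FramedLoop.speed) :=
  hF.contDiff_deriv_curve.norm ℝ fun p => (F p.1).immersed p.2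

theorem contDiff_tangent (hF : IsSmoothFamily F) :
    ContDiff ℝ ∞ (alongFamily F fun x => unitTangent x.curve) :=
  (hF.contDiff_speed.inv fun p => ((F p.1).speed_pos p.2).ne').smul hF.contDiff_deriv_curve

theorem contDiff_binormal (hF : IsSmoothFamily F) :
    ContDiff ℝ ∞ (alongFamily F FramedLoop.binormal) :=
  contDiff_cross hF.contDiff_tangent hF.contDiff_frame

theorem contDiff_deriv_tangent (hF : IsSmoothFamily F) :
    ContDiff ℝ ∞ (alongFamily F fun x => deriv (unitTangent x.curve)) := by
  rw [← partialSnd_alongFamily hF.contDiff_tangent]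
  exact contDiff_partialSnd hF.contDiff_tangent

theorem contDiff_deriv_frame (hF : IsSmoothFamily F) :
    ContDiff ℝ ∞ (alongFamily F fun x => deriv x.frame) := by
  rw [← partialSnd_alongFamily hF.contDiff_frame]
  exact contDiff_partialSnd hF.contDiff_frame

theorem contDiff_deriv_speed (hF : IsSmoothFamily F) :
    ContDiff ℝ ∞ (alongFamily F fun x => deriv x.speed) := by
  rw [← partialSnd_alongFamily hF.contDiff_speed]
  exact contDiff_partialSnd hF.contDiff_speed

theorem contDiff_twist (hF : IsSmoothFamily F) : ContDiff ℝ ∞ (alongFamily F FramedLoop.twist) :=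
  hF.contDiff_deriv_frame.inner ℝ hF.contDiff_binormal

theorem contDiff_energyDensity (hF : IsSmoothFamily F) :
    ContDiff ℝ ∞ (alongFamily F FramedLoop.energyDensity) :=
  ((hF.contDiff_speed.mul (hF.contDiff_deriv_tangent.inner ℝ hF.contDiff_deriv_tangent)).add
    (hF.contDiff_speed.mul (hF.contDiff_twist.pow 2))).add
    ((hF.contDiff_deriv_speed.pow 2).div hF.contDiff_speed
      fun p => ((F p.1).speed_pos p.2).ne')

theorem integral_partialFst_speed (hF : IsSmoothFamily F) (ε : ℝ) :
    ∫ t in (0 : ℝ)..2, partialFst (alongFamily F FramedLoop.speed) (ε, t) = 0 := by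
  have h := hasDerivAt_integral_of_contDiff (hF.contDiff_speed.of_le (by simp)) 0 2 ε
  have length_const : (fun ε => ∫ t in (0 : ℝ)..2, alongFamily F FramedLoop.speed (ε, t))
      = fun _ => ℓ := funext fun ε => (F ε).length_eq
  rw [length_const] at h
  exact h.unique (hasDerivAt_const _ _)

theorem hasDerivAt_energy (hF : IsSmoothFamily F) (ε : ℝ) :
    HasDerivAt (fun ε => energy (F ε).curve (F ε).frame)
      (∫ t in (0 : ℝ)..2, partialFst (alongFamily F FramedLoop.energyDensity) (ε, t)) ε := by
  rw [funext fun ε => (F ε).energy_eq_integral]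
  exact hasDerivAt_integral_of_contDiff (hF.contDiff_energyDensity.of_le (by simp)) 0 2 ε

theorem partialSnd_partialFst_curve (hF : IsSmoothFamily F) (p : ℝ × ℝ) :
    partialSnd (partialFst (alongFamily F FramedLoop.curve)) p
      = (F p.1).speed p.2 • partialFst (alongFamily F fun x => unitTangent x.curve) p
        + partialFst (alongFamily F FramedLoop.speed) p • unitTangent (F p.1).curve p.2 := by
  have deriv_curve : (alongFamily F fun x => deriv x.curve)
      = fun p => alongFamily F FramedLoop.speed p •
          alongFamily F (fun x => unitTangent x.curve) p :=
    funext fun p => (F p.1).deriv_curve_eq p.2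
  rw [← partialFst_partialSnd hF.contDiff_curve, partialSnd_alongFamily hF.contDiff_curve,
    deriv_curve, partialFst, fderiv_fun_smul (hF.contDiff_speed.differentiable (by simp) p)
      (hF.contDiff_tangent.differentiable (by simp) p)]
  rfl

theorem partialFst_twist (hF : IsSmoothFamily F) (p : ℝ × ℝ) :
    partialFst (alongFamily F FramedLoop.twist) p
      = partialSnd (fun p => ⟪partialFst (alongFamily F FramedLoop.frame) p,
          (F p.1).binormal p.2⟫_ℝ) p
        + ⟪cross (unitTangent (F p.1).curve p.2) (deriv (unitTangent (F p.1).curve) p.2),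
          partialFst (alongFamily F fun x => unitTangent x.curve) p⟫_ℝ := by
  have h := partialFst_inner_partialSnd_cross hF.contDiff_tangent hF.contDiff_frame
    (fun p => (F p.1).unitTangent_inner_self p.2) (fun p => (F p.1).frame_inner_self p.2)
    (fun p => (F p.1).unitTangent_inner_frame p.2) p
  rwa [partialSnd_alongFamily hF.contDiff_frame, partialSnd_alongFamily hF.contDiff_tangent] at h

/-- The flux along the curve in the first variation of the energy at a twisted circle with axis `e`
and twist `τ`. -/
def flux (F : ℝ → FramedLoop ℓ) (e : E3) (τ : ℝ) (p : ℝ × ℝ) : ℝ :=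
  2 * τ * ⟪e, partialFst (alongFamily F FramedLoop.curve) p⟫_ℝ
    + ℓ * ⟪partialSnd (alongFamily F fun x => unitTangent x.curve) p,
        partialFst (alongFamily F fun x => unitTangent x.curve) p⟫_ℝ
    + ℓ * τ * ⟪partialFst (alongFamily F FramedLoop.frame) p, (F p.1).binormal p.2⟫_ℝ

theorem contDiff_flux (hF : IsSmoothFamily F) (e : E3) (τ : ℝ) : ContDiff ℝ ∞ (flux F e τ) :=
  ((contDiff_const.mul (contDiff_const.inner ℝ (contDiff_partialFst hF.contDiff_curve))).add
    (contDiff_const.mul ((contDiff_partialSnd hF.contDiff_tangent).inner ℝ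
      (contDiff_partialFst hF.contDiff_tangent)))).add
    (contDiff_const.mul ((contDiff_partialFst hF.contDiff_frame).inner ℝ hF.contDiff_binormal))

theorem periodic_flux (e : E3) (τ : ℝ) : Function.Periodic (flux F e τ) (0, 2) := fun p => by
  have hγ := periodic_partialFst (periodic_alongFamily (F := F) FramedLoop.periodic_curve)
  have hV := periodic_partialFst (periodic_alongFamily (F := F) FramedLoop.periodic_frame)
  have hT := periodic_alongFamily (F := F) FramedLoop.periodic_unitTangent
  have hB := periodic_alongFamily (F := F) FramedLoop.periodic_binormal p
  simp only [alongFamily] at hB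
  rw [flux, flux, hγ, hV, periodic_partialFst hT, periodic_partialSnd hT, hB]

theorem partialSnd_flux (hF : IsSmoothFamily F) (e : E3) (τ : ℝ) (p : ℝ × ℝ) :
    partialSnd (flux F e τ) p
      = 2 * τ * ⟪e, partialSnd (partialFst (alongFamily F FramedLoop.curve)) p⟫_ℝ
        + ℓ * partialSnd (fun p => ⟪partialSnd (alongFamily F fun x => unitTangent x.curve) p,
            partialFst (alongFamily F fun x => unitTangent x.curve) p⟫_ℝ) p
        + ℓ * τ * partialSnd (fun p => ⟪partialFst (alongFamily F FramedLoop.frame) p,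
            (F p.1).binormal p.2⟫_ℝ) p := by
  have h1 := contDiff_partialFst hF.contDiff_curve
  have h2 := (contDiff_partialSnd hF.contDiff_tangent).inner ℝ
    (contDiff_partialFst hF.contDiff_tangent)
  have h3 := (contDiff_partialFst hF.contDiff_frame).inner ℝ hF.contDiff_binormal
  have h := ((((hasDerivAt_const p.2 e).inner ℝ
    (hasDerivAt_partialSnd (h1.differentiable (by simp)) p.1 p.2)).const_mul (2 * τ)).add
    ((hasDerivAt_partialSnd (h2.differentiable (by simp)) p.1 p.2).const_mul ℓ)).add
    ((hasDerivAt_partialSnd (h3.differentiable (by simp)) p.1 p.2).const_mul (ℓ * τ))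
  have h' := (hasDerivAt_partialSnd ((hF.contDiff_flux e τ).differentiable (by simp)) p.1 p.2)
  rw [inner_zero_left, add_zero] at h
  exact h'.unique h

end IsSmoothFamily

namespace IsTwistedCircle

variable {k τ : ℝ}

theorem partialFst_energyDensity (hF : IsSmoothFamily F) (h0 : IsTwistedCircle (F 0) k τ) (t : ℝ) :
    partialFst (alongFamily F FramedLoop.energyDensity) (0, t)
      = (k ^ 2 + τ ^ 2) * partialFst (alongFamily F FramedLoop.speed) (0, t)
        + ℓ / 2 * partialFst (fun p => ⟪partialSnd (alongFamily F fun x => unitTangent x.curve) p,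
            partialSnd (alongFamily F fun x => unitTangent x.curve) p⟫_ℝ) (0, t)
        + ℓ * τ * partialFst (alongFamily F FramedLoop.twist) (0, t) := by
  have hasDerivAt_fst {u : ℝ × ℝ → ℝ} (hu : ContDiff ℝ ∞ u) :
      HasDerivAt (fun e => u (e, t)) (partialFst u (0, t)) 0 :=
    hasDerivAt_partialFst (hu.differentiable (by simp)) 0 t
  have hr := hasDerivAt_fst hF.contDiff_speed
  have hT := hasDerivAt_fst (hF.contDiff_deriv_tangent.inner ℝ hF.contDiff_deriv_tangent)
  have hτ := hasDerivAt_fst hF.contDiff_twist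
  have hr' := hasDerivAt_fst hF.contDiff_deriv_speed
  have hr0 : alongFamily F FramedLoop.speed (0, t) ≠ 0 := ((F 0).speed_pos t).ne'
  have product_rule := ((hr.mul hT).add (hr.mul (hτ.pow 2))).add ((hr'.pow 2).div hr hr0)
  have speed_const : (F 0).speed = fun _ => ℓ / 2 := funext h0.speed_eq
  rw [(hasDerivAt_fst hF.contDiff_energyDensity).unique product_rule,
    partialSnd_alongFamily hF.contDiff_tangent]
  simp only [alongFamily, h0.inner_deriv_tangent, h0.twist_eq, speed_const, deriv_const,
    Pi.pow_apply]
  ring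

theorem partialFst_energyDensity_eq_partialSnd_flux (hF : IsSmoothFamily F)
    (h0 : IsTwistedCircle (F 0) k τ) {e : E3}
    (he : ∀ t, cross (unitTangent (F 0).curve t) (deriv (unitTangent (F 0).curve) t) = e) (t : ℝ) :
    partialFst (alongFamily F FramedLoop.energyDensity) (0, t)
      = (k ^ 2 + τ ^ 2) * partialFst (alongFamily F FramedLoop.speed) (0, t)
        + partialSnd (IsSmoothFamily.flux F e τ) (0, t) := by
  have inner_tangent : ⟪unitTangent (F 0).curve t,
      partialFst (alongFamily F fun x => unitTangent x.curve) (0, t)⟫_ℝ = 0 := by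
    rw [real_inner_comm]
    exact inner_fderiv_self_of_const (hF.contDiff_tangent.differentiable (by simp))
      (fun p => (F p.1).unitTangent_inner_self p.2) (0, t) (1, 0)
  have axis_inner_tangent : ⟪e, unitTangent (F 0).curve t⟫_ℝ = 0 := by
    rw [← he t, real_inner_comm, inner_cross_left]
  have tangent_snd_snd : partialSnd (partialSnd (alongFamily F fun x => unitTangent x.curve)) (0, t)
      = -(k ^ 2) • unitTangent (F 0).curve t := by
    rw [partialSnd_alongFamily hF.contDiff_tangent,
      partialSnd_alongFamily hF.contDiff_deriv_tangent]
    exact h0.deriv_deriv_tangent t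
  rw [h0.partialFst_energyDensity hF, partialFst_inner_partialSnd_self hF.contDiff_tangent,
    hF.partialFst_twist, hF.partialSnd_flux, hF.partialSnd_partialFst_curve, tangent_snd_snd, he,
    h0.speed_eq, inner_add_right, real_inner_smul_left, real_inner_smul_right,
    real_inner_smul_right, inner_tangent, axis_inner_tangent]
  ring

theorem hasDerivAt_energy (hF : IsSmoothFamily F) (h0 : IsTwistedCircle (F 0) k τ) :
    HasDerivAt (fun ε => energy (F ε).curve (F ε).frame) 0 0 := by
  obtain ⟨e, he⟩ := h0.axis
  have hr : Continuous fun t => partialFst (alongFamily F FramedLoop.speed) (0, t) :=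
    (contDiff_partialFst hF.contDiff_speed).continuous.comp (by fun_prop)
  have hU : Continuous fun t => partialSnd (IsSmoothFamily.flux F e τ) (0, t) :=
    (contDiff_partialSnd (hF.contDiff_flux e τ)).continuous.comp (by fun_prop)
  convert hF.hasDerivAt_energy 0 using 1
  simp only [h0.partialFst_energyDensity_eq_partialSnd_flux hF he]
  rw [intervalIntegral.integral_add ((hr.const_mul _).intervalIntegrable _ _)
    (hU.intervalIntegrable _ _), intervalIntegral.integral_const_mul, hF.integral_partialFst_speed,
    integral_partialSnd_eq_zero (hF.contDiff_flux e τ) (IsSmoothFamily.periodic_flux e τ),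
    mul_zero, add_zero]

theorem mem_criticalEnergyLevels {x : FramedLoop ℓ} (hx : IsTwistedCircle x k τ) :
    ℓ * (k ^ 2 + τ ^ 2) ∈ criticalEnergyLevels ℓ :=
  ⟨x.toModuli, fun _ hF h0 => (hx.congr (Congruent.symm (Quotient.exact h0))).hasDerivAt_energy hF,
    hx.energy_eq⟩

end IsTwistedCircle

end Family

/-! ### Spinors in two complex dimensions -/

open Complex ComplexConjugate

/-- The common length of the three vectors of the orthogonal frame induced by the spinor
`(a, b)`. -/
def spinSpeed (a b : ℂ) : ℝ := normSq a + normSq b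

/-- The Hopf map `(|a|² - |b|², 2 a̅ b)` from `ℂ²` to `ℝ × ℂ = ℝ³`: the first vector of the
orthogonal frame induced by the spinor `(a, b)`. -/
def spinTangent (a b : ℂ) : E3 :=
  !₂[normSq a - normSq b, 2 * (conj a * b).re, 2 * (conj a * b).im]

/-- The second vector of the orthogonal frame induced by the spinor `(a, b)`: the real part of the
isotropic vector `(-2ab, a² - b², i(a² + b²))`. -/
def spinNormal (a b : ℂ) : E3 :=
  !₂[-2 * (a * b).re, (a * a - b * b).re, -(a * a + b * b).im]

/-- The third vector of the orthogonal frame induced by the spinor `(a, b)`: the imaginary part of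
the isotropic vector `(-2ab, a² - b², i(a² + b²))`. -/
def spinBinormal (a b : ℂ) : E3 :=
  !₂[-2 * (a * b).im, (a * a - b * b).im, (a * a + b * b).re]

theorem spinSpeed_nonneg (a b : ℂ) : 0 ≤ spinSpeed a b :=
  add_nonneg (normSq_nonneg a) (normSq_nonneg b)

theorem spinSpeed_comm (a b : ℂ) : spinSpeed a b = spinSpeed b a := add_comm _ _

theorem inner_spinTangent_self (a b : ℂ) :
    ⟪spinTangent a b, spinTangent a b⟫_ℝ = spinSpeed a b ^ 2 := by
  simp [inner_eq_sum, spinTangent, spinSpeed, normSq_apply, -inner_self_eq_norm_sq_to_K]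
  ring

theorem inner_spinNormal_self (a b : ℂ) :
    ⟪spinNormal a b, spinNormal a b⟫_ℝ = spinSpeed a b ^ 2 := by
  simp [inner_eq_sum, spinNormal, spinSpeed, normSq_apply, -inner_self_eq_norm_sq_to_K]
  ring

theorem inner_spinTangent_spinNormal (a b : ℂ) : ⟪spinTangent a b, spinNormal a b⟫_ℝ = 0 := by
  simp [inner_eq_sum, spinTangent, spinNormal, normSq_apply]
  ring

theorem cross_spinTangent_spinNormal (a b : ℂ) :
    cross (spinTangent a b) (spinNormal a b) = spinSpeed a b • spinBinormal a b := by
  ext i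
  fin_cases i <;>
    simp [cross, crossProduct, spinTangent, spinNormal, spinBinormal, spinSpeed, normSq_apply] <;>
    ring

theorem cross_spinNormal_spinBinormal (a b : ℂ) :
    cross (spinNormal a b) (spinBinormal a b) = spinSpeed a b • spinTangent a b := by
  ext i
  fin_cases i <;>
    simp [cross, crossProduct, spinTangent, spinNormal, spinBinormal, spinSpeed, normSq_apply] <;>
    ring

theorem norm_spinTangent (a b : ℂ) : ‖spinTangent a b‖ = spinSpeed a b := by
  rw [norm_eq_sqrt_real_inner, inner_spinTangent_self, Real.sqrt_sq (spinSpeed_nonneg a b)]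

theorem norm_spinNormal (a b : ℂ) : ‖spinNormal a b‖ = spinSpeed a b := by
  rw [norm_eq_sqrt_real_inner, inner_spinNormal_self, Real.sqrt_sq (spinSpeed_nonneg a b)]

theorem spinSpeed_unit_smul (σ : ℤˣ) (a b : ℂ) : spinSpeed (σ • a) (σ • b) = spinSpeed a b := by
  rcases Int.units_eq_one_or σ with rfl | rfl <;> simp [spinSpeed, Units.smul_def]

theorem spinTangent_unit_smul (σ : ℤˣ) (a b : ℂ) :
    spinTangent (σ • a) (σ • b) = spinTangent a b := by
  rcases Int.units_eq_one_or σ with rfl | rfl <;> simp [spinTangent, Units.smul_def]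

theorem spinNormal_unit_smul (σ : ℤˣ) (a b : ℂ) :
    spinNormal (σ • a) (σ • b) = spinNormal a b := by
  rcases Int.units_eq_one_or σ with rfl | rfl <;> simp [spinNormal, Units.smul_def]

section Smooth

variable {G : Type*} [NormedAddCommGroup G] [NormedSpace ℝ G] {n : WithTop ℕ∞} {a b : G → ℂ}

@[fun_prop]
theorem contDiff_re (ha : ContDiff ℝ n a) : ContDiff ℝ n fun p => (a p).re :=
  reCLM.contDiff.comp ha

@[fun_prop]
theorem contDiff_im (ha : ContDiff ℝ n a) : ContDiff ℝ n fun p => (a p).im :=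
  imCLM.contDiff.comp ha

theorem contDiff_spinSpeed (ha : ContDiff ℝ n a) (hb : ContDiff ℝ n b) :
    ContDiff ℝ n fun p => spinSpeed (a p) (b p) := by
  simp only [spinSpeed, normSq_apply]
  fun_prop

theorem contDiff_vec3 {f g h : G → ℝ} (hf : ContDiff ℝ n f) (hg : ContDiff ℝ n g)
    (hh : ContDiff ℝ n h) : ContDiff ℝ n fun p => (!₂[f p, g p, h p] : E3) := by
  refine contDiff_euclidean.2 fun i => ?_
  fin_cases i
  exacts [hf, hg, hh]

theorem contDiff_spinTangent (ha : ContDiff ℝ n a) (hb : ContDiff ℝ n b) :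
    ContDiff ℝ n fun p => spinTangent (a p) (b p) := by
  simp only [spinTangent, normSq_apply, mul_re, mul_im, conj_re, conj_im]
  exact contDiff_vec3 (by fun_prop) (by fun_prop) (by fun_prop)

theorem contDiff_spinNormal (ha : ContDiff ℝ n a) (hb : ContDiff ℝ n b) :
    ContDiff ℝ n fun p => spinNormal (a p) (b p) :=
  contDiff_vec3 (by fun_prop) (by fun_prop) (by fun_prop)

end Smooth

section Derivatives

variable {a b : ℝ → ℂ} {a' b' : ℂ} {t : ℝ}

theorem hasDerivAt_re (ha : HasDerivAt a a' t) : HasDerivAt (fun t => (a t).re) a'.re t :=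
  reCLM.hasFDerivAt.comp_hasDerivAt t ha

theorem hasDerivAt_im (ha : HasDerivAt a a' t) : HasDerivAt (fun t => (a t).im) a'.im t :=
  imCLM.hasFDerivAt.comp_hasDerivAt t ha

theorem hasDerivAt_vec3 {f g h : ℝ → ℝ} {f' g' h' t : ℝ} (hf : HasDerivAt f f' t)
    (hg : HasDerivAt g g' t) (hh : HasDerivAt h h' t) :
    HasDerivAt (fun t => (!₂[f t, g t, h t] : E3)) !₂[f', g', h'] t := by
  have components : HasDerivAt (fun t => ![f t, g t, h t]) ![f', g', h'] t := by
    refine hasDerivAt_pi.2 fun i => ?_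
    fin_cases i
    exacts [hf, hg, hh]
  exact (EuclideanSpace.equiv (Fin 3) ℝ).symm.hasFDerivAt.comp_hasDerivAt t components

theorem hasDerivAt_conj_mul (ha : HasDerivAt a a' t) (hb : HasDerivAt b b' t) :
    HasDerivAt (fun t => conj (a t) * b t) (conj a' * b t + conj (a t) * b') t :=
  ha.star.mul hb

theorem hasDerivAt_normSq (ha : HasDerivAt a a' t) :
    HasDerivAt (fun t => normSq (a t)) (2 * (conj (a t) * a').re) t := by
  have normSq_eq : ∀ z : ℂ, normSq z = (conj z * z).re := fun z => by simp [normSq_apply]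
  simp only [normSq_eq]
  exact (hasDerivAt_re (hasDerivAt_conj_mul ha ha)).congr_deriv (by simp; ring)

theorem hasDerivAt_spinTangent (ha : HasDerivAt a a' t) (hb : HasDerivAt b b' t) :
    HasDerivAt (fun t => spinTangent (a t) (b t))
      !₂[2 * (conj (a t) * a').re - 2 * (conj (b t) * b').re,
        2 * (conj a' * b t + conj (a t) * b').re, 2 * (conj a' * b t + conj (a t) * b').im] t :=
  have deriv_prod := hasDerivAt_conj_mul ha hb
  hasDerivAt_vec3 ((hasDerivAt_normSq ha).sub (hasDerivAt_normSq hb))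
    ((hasDerivAt_re deriv_prod).const_mul 2) ((hasDerivAt_im deriv_prod).const_mul 2)

theorem hasDerivAt_spinNormal (ha : HasDerivAt a a' t) (hb : HasDerivAt b b' t) :
    HasDerivAt (fun t => spinNormal (a t) (b t))
      !₂[-2 * (a' * b t + a t * b').re, (a' * a t + a t * a' - (b' * b t + b t * b')).re,
        -(a' * a t + a t * a' + (b' * b t + b t * b')).im] t :=
  hasDerivAt_vec3 ((hasDerivAt_re (ha.mul hb)).const_mul (-2))
    (hasDerivAt_re ((ha.mul ha).sub (hb.mul hb)))
    (hasDerivAt_im ((ha.mul ha).add (hb.mul hb))).neg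

theorem inner_deriv_spinNormal_spinBinormal (ha : HasDerivAt a a' t) (hb : HasDerivAt b b' t) :
    ⟪deriv (fun t => spinNormal (a t) (b t)) t, spinBinormal (a t) (b t)⟫_ℝ
      = -2 * (conj (a t) * a' + conj (b t) * b').im * spinSpeed (a t) (b t) := by
  rw [(hasDerivAt_spinNormal ha hb).deriv]
  simp [inner_eq_sum, spinBinormal, spinSpeed, normSq_apply]
  ring

/-- The Hopf map loses exactly the component of the derivative along the Hopf fibre. -/
theorem normSq_deriv_spinTangent_add_sq (ha : HasDerivAt a a' t) (hb : HasDerivAt b b' t) :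
    ⟪deriv (fun t => spinTangent (a t) (b t)) t, deriv (fun t => spinTangent (a t) (b t)) t⟫_ℝ
      + (-2 * (conj (a t) * a' + conj (b t) * b').im) ^ 2
      = 4 * spinSpeed (a t) (b t) * spinSpeed a' b' := by
  rw [(hasDerivAt_spinTangent ha hb).deriv]
  simp [inner_eq_sum, spinSpeed, normSq_apply, -inner_self_eq_norm_sq_to_K]
  ring

end Derivatives

/-! ### Sections of the two flat complex line bundles over the circle -/

/-- The space of smooth functions `f : ℝ → ℂ` with `f (t + 2) = σ f t`, where `σ = ±1`. -/
def quasiPeriodicSubmodule (σ : ℤˣ) : Submodule ℂ (ℝ → ℂ) where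
  carrier := {f | ContDiff ℝ ∞ f ∧ ∀ t, f (t + 2) = σ • f t}
  zero_mem' := ⟨contDiff_const, fun _ => (smul_zero σ).symm⟩
  add_mem' hf hg := ⟨hf.1.add hg.1, fun t => by simp [hf.2 t, hg.2 t]⟩
  smul_mem' c f hf := ⟨contDiff_const.smul hf.1, fun t => by
    simp only [Pi.smul_apply, hf.2 t, smul_comm c σ]⟩

/-- The smooth functions `f : ℝ → ℂ` with `f (t + 2) = σ f t`, or equivalently the smooth sections
of the trivial (`σ = 1`) or nontrivial (`σ = -1`) flat line bundle over `ℝ / 2ℤ`. This copy of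
`quasiPeriodicSubmodule` carries the `L²` norm instead of the topology of pointwise convergence. -/
def LineSection (σ : ℤˣ) : Type := quasiPeriodicSubmodule σ

namespace LineSection

variable {σ : ℤˣ}

instance : AddCommGroup (LineSection σ) := inferInstanceAs (AddCommGroup (quasiPeriodicSubmodule σ))

instance : Module ℂ (LineSection σ) := inferInstanceAs (Module ℂ (quasiPeriodicSubmodule σ))

instance : FunLike (LineSection σ) ℝ ℂ := ⟨fun f => f.1, Subtype.val_injective⟩

@[ext]
theorem ext {f g : LineSection σ} (h : ∀ t, f t = g t) : f = g := DFunLike.ext f g h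

theorem add_apply (f g : LineSection σ) (t : ℝ) : (f + g) t = f t + g t := rfl

@[simp]
theorem smul_apply (c : ℂ) (f : LineSection σ) (t : ℝ) : (c • f) t = c * f t := rfl

@[simp]
theorem zero_apply (t : ℝ) : (0 : LineSection σ) t = 0 := rfl

theorem contDiff (f : LineSection σ) : ContDiff ℝ ∞ f := f.2.1

@[fun_prop]
theorem continuous (f : LineSection σ) : Continuous f := f.contDiff.continuous

theorem differentiable (f : LineSection σ) : Differentiable ℝ f :=
  f.contDiff.differentiable (by simp)

theorem add_two (f : LineSection σ) (t : ℝ) : f (t + 2) = σ • f t := f.2.2 t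

theorem conj_mul_periodic (f g : LineSection σ) :
    Function.Periodic (fun t => conj (f t) * g t) 2 := fun t => by
  dsimp only
  rw [f.add_two, g.add_two]
  rcases Int.units_eq_one_or σ with rfl | rfl <;> simp [Units.smul_def]

theorem integral_conj_mul_self (f : LineSection σ) :
    ∫ t in (0 : ℝ)..2, conj (f t) * f t = ((∫ t in (0 : ℝ)..2, normSq (f t) : ℝ) : ℂ) := by
  simp only [← normSq_eq_conj_mul_self]
  exact intervalIntegral.integral_ofReal

theorem eq_zero_of_integral_normSq_eq_zero {f : LineSection σ}
    (h : ∫ t in (0 : ℝ)..2, normSq (f t) = 0) : f = 0 := by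
  by_contra! hf
  obtain ⟨t, ht⟩ := DFunLike.exists_ne hf
  obtain ⟨s, hs, hst⟩ := (f.conj_mul_periodic f).exists_mem_Ico₀ two_pos t
  simp only [← normSq_eq_conj_mul_self, ofReal_inj] at hst
  have integral_pos : 0 < ∫ t in (0 : ℝ)..2, normSq (f t) :=
    intervalIntegral.integral_pos two_pos (continuous_normSq.comp f.continuous).continuousOn
      (fun x _ => normSq_nonneg _)
      ⟨s, Set.Ico_subset_Icc_self hs, hst ▸ normSq_pos.2 ht⟩
  exact integral_pos.ne' h

/-- The `L²` inner product over one period. -/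
@[reducible]
def innerCore (σ : ℤˣ) : InnerProductSpace.Core ℂ (LineSection σ) where
  inner f g := ∫ t in (0 : ℝ)..2, conj (f t) * g t
  conj_inner_symm f g := by
    simp only [intervalIntegral, map_sub, ← integral_conj, map_mul, conj_conj, mul_comm]
  re_inner_nonneg f := by
    rw [integral_conj_mul_self]
    exact intervalIntegral.integral_nonneg two_pos.le fun t _ => normSq_nonneg _
  add_left f g k := by
    simp only [add_apply, map_add, add_mul]
    exact intervalIntegral.integral_add (Continuous.intervalIntegrable (by fun_prop) _ _)
      (Continuous.intervalIntegrable (by fun_prop) _ _)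
  smul_left f g c := by
    simp only [smul_apply, map_mul, mul_assoc, intervalIntegral.integral_const_mul]
  definite f h := eq_zero_of_integral_normSq_eq_zero <| by
    rwa [integral_conj_mul_self, ofReal_eq_zero] at h

instance : NormedAddCommGroup (LineSection σ) := (innerCore σ).toNormedAddCommGroup

instance : InnerProductSpace ℂ (LineSection σ) := .ofCore (innerCore σ).toCore

theorem inner_def (f g : LineSection σ) : ⟪f, g⟫_ℂ = ∫ t in (0 : ℝ)..2, conj (f t) * g t := rfl

theorem norm_sq_eq (f : LineSection σ) : ‖f‖ ^ 2 = ∫ t in (0 : ℝ)..2, normSq (f t) := by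
  have h := f.integral_conj_mul_self
  rw [← inner_def, inner_self_eq_norm_sq_to_K] at h
  exact ofReal_injective ((ofReal_pow _ 2).trans h)

/-- Differentiation of sections. -/
def derivative (σ : ℤˣ) : LineSection σ →ₗ[ℂ] LineSection σ where
  toFun f := ⟨deriv f, (contDiff_infty_iff_deriv.1 f.contDiff).2, fun t => by
    rw [← deriv_comp_add_const, funext f.add_two]
    exact deriv_const_smul _ (f.differentiable t)⟩
  map_add' f g := ext fun t => deriv_add (f.differentiable t) (g.differentiable t)
  map_smul' c f := ext fun t => deriv_const_mul c (f.differentiable t)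

theorem hasDerivAt (f : LineSection σ) (t : ℝ) : HasDerivAt f (derivative σ f t) t :=
  (f.differentiable t).hasDerivAt

theorem inner_derivative_left (f g : LineSection σ) :
    ⟪derivative σ f, g⟫_ℂ = -⟪f, derivative σ g⟫_ℂ := by
  have product_rule : ∀ t, HasDerivAt (fun t => conj (f t) * g t)
      (conj (derivative σ f t) * g t + conj (f t) * derivative σ g t) t := fun t =>
    hasDerivAt_conj_mul (f.hasDerivAt t) (g.hasDerivAt t)
  have h := intervalIntegral.integral_eq_sub_of_hasDerivAt (fun t _ => product_rule t)
    (Continuous.intervalIntegrable (by fun_prop) 0 2)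
  rw [intervalIntegral.integral_add (Continuous.intervalIntegrable (by fun_prop) _ _)
    (Continuous.intervalIntegrable (by fun_prop) _ _)] at h
  have boundary : conj (f 2) * g 2 = conj (f 0) * g 0 := by simpa using f.conj_mul_periodic g 0
  rw [boundary, sub_self] at h
  exact eq_neg_of_add_eq_zero_left h

end LineSection

/-! ### Framed loops and closed spinors -/

section

variable {σ : ℤˣ}

theorem periodic_spinTangent (a b : LineSection σ) :
    Function.Periodic (fun t => spinTangent (a t) (b t)) 2 := fun t => by
  dsimp only
  rw [a.add_two, b.add_two, spinTangent_unit_smul]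

theorem continuous_spinTangent (a b : LineSection σ) :
    Continuous fun t => spinTangent (a t) (b t) :=
  (contDiff_spinTangent a.contDiff b.contDiff).continuous

theorem integral_spinSpeed (a b : LineSection σ) :
    ∫ t in (0 : ℝ)..2, spinSpeed (a t) (b t) = ‖a‖ ^ 2 + ‖b‖ ^ 2 := by
  rw [a.norm_sq_eq, b.norm_sq_eq]
  exact intervalIntegral.integral_add
    ((continuous_normSq.comp a.continuous).intervalIntegrable _ _)
    ((continuous_normSq.comp b.continuous).intervalIntegrable _ _)

theorem integral_spinTangent (a b : LineSection σ) :
    ∫ t in (0 : ℝ)..2, spinTangent (a t) (b t)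
      = !₂[‖a‖ ^ 2 - ‖b‖ ^ 2, 2 * (⟪a, b⟫_ℂ).re, 2 * (⟪a, b⟫_ℂ).im] := by
  have normSq_integrable (f : LineSection σ) :
      IntervalIntegrable (fun t => normSq (f t)) MeasureTheory.volume 0 2 :=
    (continuous_normSq.comp f.continuous).intervalIntegrable _ _
  have product_integrable :
      IntervalIntegrable (fun t => conj (a t) * b t) MeasureTheory.volume 0 2 :=
    Continuous.intervalIntegrable (by fun_prop) _ _
  ext i
  rw [← PiLp.proj_apply (𝕜 := ℝ) 2 (fun _ : Fin 3 => ℝ) i,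
    ← (PiLp.proj (𝕜 := ℝ) 2 (fun _ : Fin 3 => ℝ) i).intervalIntegral_comp_comm
      ((continuous_spinTangent a b).intervalIntegrable _ _)]
  fin_cases i
  · simp [spinTangent, a.norm_sq_eq, b.norm_sq_eq,
      intervalIntegral.integral_sub (normSq_integrable a) (normSq_integrable b)]
  · have := reCLM.intervalIntegral_comp_comm product_integrable
    simp_all [spinTangent, LineSection.inner_def]
  · have := imCLM.intervalIntegral_comp_comm product_integrable
    simp_all [spinTangent, LineSection.inner_def]

/-- The Dirichlet energy of a pair of sections, for the `L²` norm over one period. -/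
def dirichletEnergy (a b : LineSection σ) : ℝ :=
  ‖LineSection.derivative σ a‖ ^ 2 + ‖LineSection.derivative σ b‖ ^ 2

theorem dirichletEnergy_comm (a b : LineSection σ) : dirichletEnergy a b = dirichletEnergy b a :=
  add_comm _ _

/-- The sections `a, b` form a spinor field inducing the framed loop `x`. -/
structure IsSpinor {ℓ : ℝ} (x : FramedLoop ℓ) (a b : LineSection σ) : Prop where
  tangent : ∀ t, deriv x.curve t = spinTangent (a t) (b t)
  frame : ∀ t, spinSpeed (a t) (b t) • x.frame t = spinNormal (a t) (b t)

/-- The spinor fields inducing framed loops of length `ℓ`: the orthogonality relation and the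
equality of the two norms express that the induced curve closes up. -/
structure IsClosedSpinor (ℓ : ℝ) (a b : LineSection σ) : Prop where
  ne_zero : ∀ t, spinSpeed (a t) (b t) ≠ 0
  norm_sq_fst : ‖a‖ ^ 2 = ℓ / 2
  norm_sq_snd : ‖b‖ ^ 2 = ℓ / 2
  inner_eq_zero : ⟪a, b⟫_ℂ = 0

end

namespace IsSpinor

variable {ℓ : ℝ} {σ : ℤˣ} {x : FramedLoop ℓ} {a b : LineSection σ}

theorem speed (h : IsSpinor x a b) (t : ℝ) : x.speed t = spinSpeed (a t) (b t) := by
  rw [FramedLoop.speed, h.tangent, norm_spinTangent]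

theorem ne_zero (h : IsSpinor x a b) (t : ℝ) : spinSpeed (a t) (b t) ≠ 0 :=
  h.speed t ▸ (x.speed_pos t).ne'

theorem binormal (h : IsSpinor x a b) (t : ℝ) :
    spinSpeed (a t) (b t) • x.binormal t = spinBinormal (a t) (b t) := by
  refine smul_right_injective E3 (h.ne_zero t) ?_
  dsimp only
  rw [← cross_spinTangent_spinNormal, ← h.tangent, ← h.frame, x.deriv_curve_eq, h.speed,
    cross_smul_smul, smul_smul, FramedLoop.binormal]

theorem speed_mul_twist (h : IsSpinor x a b) (t : ℝ) :
    x.speed t * x.twist t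
      = -2 * (conj (a t) * LineSection.derivative σ a t
        + conj (b t) * LineSection.derivative σ b t).im := by
  have deriv_normal : HasDerivAt (fun t => spinNormal (a t) (b t))
      (x.speed t • deriv x.frame t + deriv x.speed t • x.frame t) t := by
    simp only [← h.frame, ← h.speed]
    exact (x.differentiable_speed t).hasDerivAt.smul (x.differentiable_frame t).hasDerivAt
  have inner_binormal := inner_deriv_spinNormal_spinBinormal (a.hasDerivAt t) (b.hasDerivAt t)
  rw [deriv_normal.deriv, ← h.binormal, ← h.speed] at inner_binormal
  simp only [inner_add_left, real_inner_smul_left, real_inner_smul_right,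
    x.frame_inner_binormal, mul_zero, add_zero] at inner_binormal
  refine mul_right_cancel₀ (x.speed_pos t).ne' (Eq.trans ?_ inner_binormal)
  rw [FramedLoop.twist]
  ring

theorem energy_eq (h : IsSpinor x a b) :
    energy x.curve x.frame = 4 * dirichletEnergy a b := by
  rw [x.energy_eq_integral, dirichletEnergy, ← integral_spinSpeed,
    ← intervalIntegral.integral_const_mul]
  refine intervalIntegral.integral_congr fun t _ => mul_left_cancel₀ (x.speed_pos t).ne' ?_
  rw [x.speed_mul_energyDensity, h.speed_mul_twist, funext h.tangent,
    normSq_deriv_spinTangent_add_sq (a.hasDerivAt t) (b.hasDerivAt t), h.speed]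
  ring

theorem isClosedSpinor (h : IsSpinor x a b) : IsClosedSpinor ℓ a b := by
  have integral_tangent : ∫ t in (0 : ℝ)..2, spinTangent (a t) (b t) = 0 := by
    simp only [← h.tangent]
    rw [intervalIntegral.integral_deriv_eq_sub
      (fun t _ => x.smooth_curve.differentiable (by simp) t)
      (x.smooth_deriv.continuous.intervalIntegrable _ _), sub_eq_zero]
    simpa using x.periodic_curve 0
  have integral_speed : ∫ t in (0 : ℝ)..2, spinSpeed (a t) (b t) = ℓ := by
    simp only [← h.speed]
    exact x.length_eq
  rw [integral_spinTangent] at integral_tangent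
  rw [integral_spinSpeed] at integral_speed
  have norms_eq : ‖a‖ ^ 2 - ‖b‖ ^ 2 = 0 := congrArg (· 0) integral_tangent
  have re_eq_zero : (⟪a, b⟫_ℂ).re = 0 := by simpa using congrArg (· 1) integral_tangent
  have im_eq_zero : (⟪a, b⟫_ℂ).im = 0 := by simpa using congrArg (· 2) integral_tangent
  exact ⟨h.ne_zero, by linarith, by linarith, Complex.ext re_eq_zero im_eq_zero⟩

theorem congruent {y : FramedLoop ℓ} (hx : IsSpinor x a b) (hy : IsSpinor y a b) :
    Congruent x y := by
  refine ⟨LinearIsometryEquiv.refl ℝ E3, y.curve 0 - x.curve 0, 0, LinearMap.det_id, fun t => ?_,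
    fun t => ?_⟩
  · have difference_const : y.curve t - x.curve t = y.curve 0 - x.curve 0 :=
      is_const_of_deriv_eq_zero
        ((y.smooth_curve.differentiable (by simp)).sub (x.smooth_curve.differentiable (by simp)))
        (fun s => by
          rw [deriv_sub (y.smooth_curve.differentiable (by simp) s)
            (x.smooth_curve.differentiable (by simp) s), hy.tangent, hx.tangent, sub_self]) t 0
    rw [← difference_const]
    simp
  · have frame_eq : y.frame t = x.frame t :=
      smul_right_injective E3 (hx.ne_zero t) ((hy.frame t).trans (hx.frame t).symm)
    simp [twistFrame, frame_eq]

end IsSpinor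

namespace IsClosedSpinor

variable {ℓ : ℝ} {σ : ℤˣ} {a b : LineSection σ}

theorem swap (h : IsClosedSpinor ℓ a b) : IsClosedSpinor ℓ b a where
  ne_zero t := spinSpeed_comm (a t) (b t) ▸ h.ne_zero t
  norm_sq_fst := h.norm_sq_snd
  norm_sq_snd := h.norm_sq_fst
  inner_eq_zero := inner_eq_zero_symm.1 h.inner_eq_zero

theorem length_pos (h : IsClosedSpinor ℓ a b) : 0 < ℓ := by
  have length_nonneg : 0 ≤ ℓ := by linarith [h.norm_sq_fst, sq_nonneg ‖a‖]
  refine length_nonneg.lt_of_ne' fun hℓ => h.ne_zero 0 ?_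
  have ha : a = 0 := norm_eq_zero.1 (sq_eq_zero_iff.1 (by rw [h.norm_sq_fst, hℓ, zero_div]))
  have hb : b = 0 := norm_eq_zero.1 (sq_eq_zero_iff.1 (by rw [h.norm_sq_snd, hℓ, zero_div]))
  simp [ha, hb, spinSpeed]

theorem fst_ne_zero (h : IsClosedSpinor ℓ a b) : a ≠ 0 := by
  rintro rfl
  exact (half_pos h.length_pos).ne (by simpa using h.norm_sq_fst)

theorem integral_spinTangent_eq_zero (h : IsClosedSpinor ℓ a b) :
    ∫ t in (0 : ℝ)..2, spinTangent (a t) (b t) = 0 := by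
  rw [integral_spinTangent, h.norm_sq_fst, h.norm_sq_snd, h.inner_eq_zero]
  ext i
  fin_cases i <;> simp

theorem hasDerivAt_integral_spinTangent (a b : LineSection σ) (t : ℝ) :
    HasDerivAt (fun t => ∫ s in (0 : ℝ)..t, spinTangent (a s) (b s)) (spinTangent (a t) (b t)) t :=
  ((continuous_spinTangent a b).integral_hasStrictDerivAt 0 t).hasDerivAt

/-- The framed loop, starting at the origin, which is induced by a closed spinor field. -/
def toFramedLoop (h : IsClosedSpinor ℓ a b) : FramedLoop ℓ where
  curve t := ∫ s in (0 : ℝ)..t, spinTangent (a s) (b s)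
  frame t := (spinSpeed (a t) (b t))⁻¹ • spinNormal (a t) (b t)
  smooth_curve := contDiff_infty_iff_deriv.2
    ⟨fun t => (hasDerivAt_integral_spinTangent a b t).differentiableAt, by
      rw [funext fun t => (hasDerivAt_integral_spinTangent a b t).deriv]
      exact contDiff_spinTangent a.contDiff b.contDiff⟩
  smooth_frame := ((contDiff_spinSpeed a.contDiff b.contDiff).inv h.ne_zero).smul
    (contDiff_spinNormal a.contDiff b.contDiff)
  periodic_curve t := by
    have integrable : ∀ r s, IntervalIntegrable (fun t => spinTangent (a t) (b t))
        MeasureTheory.volume r s := (continuous_spinTangent a b).intervalIntegrable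
    have period_integral := (periodic_spinTangent a b).intervalIntegral_add_eq t 0
    rw [zero_add, h.integral_spinTangent_eq_zero] at period_integral
    dsimp only
    rw [← intervalIntegral.integral_add_adjacent_intervals (integrable 0 t) (integrable t (t + 2)),
      period_integral, add_zero]
  periodic_frame t := by
    dsimp only
    rw [a.add_two, b.add_two, spinSpeed_unit_smul, spinNormal_unit_smul]
  immersed t := by
    rw [(hasDerivAt_integral_spinTangent a b t).deriv, ← norm_ne_zero_iff, norm_spinTangent]
    exact h.ne_zero t
  unit_frame t := by
    rw [norm_smul, norm_inv, norm_spinNormal, Real.norm_of_nonneg (spinSpeed_nonneg _ _),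
      inv_mul_cancel₀ (h.ne_zero t)]
  normal_frame t := by
    rw [(hasDerivAt_integral_spinTangent a b t).deriv, real_inner_smul_right,
      inner_spinTangent_spinNormal, mul_zero]
  length_eq := by
    simp only [length, (hasDerivAt_integral_spinTangent a b _).deriv, norm_spinTangent]
    rw [integral_spinSpeed, h.norm_sq_fst, h.norm_sq_snd, add_halves]

theorem isSpinor_toFramedLoop (h : IsClosedSpinor ℓ a b) : IsSpinor h.toFramedLoop a b where
  tangent t := (hasDerivAt_integral_spinTangent a b t).deriv
  frame t := smul_inv_smul₀ (h.ne_zero t) _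

theorem isSmoothFamily {A B : ℝ → LineSection σ} (h : ∀ ε, IsClosedSpinor ℓ (A ε) (B ε))
    (hA : ContDiff ℝ ∞ fun p : ℝ × ℝ => A p.1 p.2) (hB : ContDiff ℝ ∞ fun p : ℝ × ℝ => B p.1 p.2) :
    IsSmoothFamily fun ε => (h ε).toFramedLoop :=
  ⟨contDiff_parametric_primitive (contDiff_spinTangent hA hB),
    ((contDiff_spinSpeed hA hB).inv fun p => (h p.1).ne_zero p.2).smul (contDiff_spinNormal hA hB)⟩

end IsClosedSpinor

/-! ### Lifting framed loops to spinors -/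

theorem spinNormal_and_spinBinormal_eq {V W : E3} {a b : ℂ} (norm_eq : ⟪V, V⟫_ℝ = ⟪W, W⟫_ℝ)
    (orthogonal : ⟪V, W⟫_ℝ = 0) (ha : a ≠ 0)
    (ha_sq : a ^ 2 = ⟨(V 1 + W 2) / 2, (W 1 - V 2) / 2⟩) (hab : a * b = ⟨-V 0 / 2, -W 0 / 2⟩) :
    spinNormal a b = V ∧ spinBinormal a b = W := by
  rw [inner_eq_sum] at norm_eq orthogonal
  rw [inner_eq_sum] at norm_eq
  have hb_sq : b ^ 2 = ⟨(W 2 - V 1) / 2, -(W 1 + V 2) / 2⟩ := by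
    refine mul_left_cancel₀ (pow_ne_zero 2 ha) ?_
    rw [← mul_pow, hab, ha_sq, sq]
    apply Complex.ext <;> simp only [mul_re, mul_im] <;> linarith
  rw [sq] at ha_sq hb_sq
  constructor <;> ext i <;> fin_cases i <;>
    simp [spinNormal, spinBinormal, -mul_re, -mul_im, hab, ha_sq, hb_sq] <;> ring

theorem contDiff_complex_mk {f g : ℝ → ℝ} (hf : ContDiff ℝ ∞ f) (hg : ContDiff ℝ ∞ g) :
    ContDiff ℝ ∞ fun t => (⟨f t, g t⟩ : ℂ) := by
  simp only [mk_eq_add_mul_I]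
  exact (ofRealCLM.contDiff.comp hf).add ((ofRealCLM.contDiff.comp hg).mul contDiff_const)

theorem exists_contDiff_sqrt {f : ℝ → ℂ} (hf : ContDiff ℝ ∞ f) (h0 : ∀ t, f t ≠ 0) :
    ∃ a : ℝ → ℂ, ContDiff ℝ ∞ a ∧ ∀ t, a t ^ 2 = f t := by
  have half_logDeriv_contDiff : ContDiff ℝ ∞ fun t => deriv f t / (2 * f t) := by
    simp only [div_eq_mul_inv]
    exact (contDiff_infty_iff_deriv.1 hf).2.mul
      ((contDiff_const.mul hf).inv fun t => mul_ne_zero two_ne_zero (h0 t))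
  set Φ : ℝ → ℂ := fun t => ∫ s in (0 : ℝ)..t, deriv f s / (2 * f s) with hΦ
  have hasDerivAt_Φ (t : ℝ) : HasDerivAt Φ (deriv f t / (2 * f t)) t :=
    (half_logDeriv_contDiff.continuous.integral_hasStrictDerivAt 0 t).hasDerivAt
  have contDiff_Φ : ContDiff ℝ ∞ Φ := contDiff_infty_iff_deriv.2
    ⟨fun t => (hasDerivAt_Φ t).differentiableAt, by
      rwa [funext fun t => (hasDerivAt_Φ t).deriv]⟩
  obtain ⟨z, hz⟩ := IsAlgClosed.exists_pow_nat_eq (f 0) two_pos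
  refine ⟨fun t => z * exp (Φ t), contDiff_const.mul contDiff_Φ.cexp, fun t => ?_⟩
  have hasDerivAt_ratio (t : ℝ) : HasDerivAt (fun t => (z * exp (Φ t)) ^ 2 / f t) 0 t := by
    refine ((((hasDerivAt_Φ t).cexp.const_mul z).pow 2).div
      (hf.differentiable (by simp) t).hasDerivAt (h0 t)).congr_deriv ?_
    have := h0 t
    simp only [Pi.pow_apply, Nat.add_one_sub_one, Nat.cast_ofNat]
    field_simp
    ring
  have ratio_const := is_const_of_deriv_eq_zero (fun t => (hasDerivAt_ratio t).differentiableAt)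
    (fun t => (hasDerivAt_ratio t).deriv) t 0
  simpa [hΦ, hz, h0 0, div_eq_one_iff_eq (h0 t)] using ratio_const

theorem exists_lineSection_sq_eq {f : ℝ → ℂ} (hf : ContDiff ℝ ∞ f) (h0 : ∀ t, f t ≠ 0)
    (hp : Function.Periodic f 2) : ∃ (σ : ℤˣ) (a : LineSection σ), ∀ t, a t ^ 2 = f t := by
  obtain ⟨a, ha, ha_sq⟩ := exists_contDiff_sqrt hf h0
  have a_ne_zero (t : ℝ) : a t ≠ 0 := fun h => h0 t (by simp [← ha_sq, h])
  have shift_sq (t : ℝ) : a (t + 2) ^ 2 = a t ^ 2 := by rw [ha_sq, ha_sq, hp]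
  rcases isPreconnected_univ.eq_or_eq_neg_of_sq_eq (f := fun t => a (t + 2)) (g := a)
    (ha.continuous.comp (continuous_add_const 2)).continuousOn ha.continuous.continuousOn
    (fun t _ => shift_sq t) (fun {t} _ => a_ne_zero t) with h | h
  · exact ⟨1, ⟨a, ha, fun t => by simpa using h (Set.mem_univ t)⟩, ha_sq⟩
  · exact ⟨-1, ⟨a, ha, fun t => by simpa using h (Set.mem_univ t)⟩, ha_sq⟩

theorem LineSection.exists_mul_eq {σ : ℤˣ} (a : LineSection σ) (ha : ∀ t, a t ≠ 0) {f : ℝ → ℂ}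
    (hf : ContDiff ℝ ∞ f) (hp : Function.Periodic f 2) :
    ∃ b : LineSection σ, ∀ t, a t * b t = f t := by
  refine ⟨⟨fun t => (a t)⁻¹ * f t, (a.contDiff.inv ha).mul hf, fun t => ?_⟩,
    fun t => mul_inv_cancel_left₀ (ha t) (f t)⟩
  dsimp only
  rw [hp, a.add_two]
  rcases Int.units_eq_one_or σ with rfl | rfl <;> simp [Units.smul_def]

namespace FramedLoop

variable {ℓ : ℝ}

theorem isSpinor_of_mul_eq (x : FramedLoop ℓ) {σ : ℤˣ} {a b : LineSection σ}
    (ha : ∀ t, a t ≠ 0)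
    (ha_sq : ∀ t, a t ^ 2 = ⟨x.speed t * (x.frame t 1 + x.binormal t 2) / 2,
      x.speed t * (x.binormal t 1 - x.frame t 2) / 2⟩)
    (hab : ∀ t, a t * b t = ⟨-(x.speed t * x.frame t 0) / 2, -(x.speed t * x.binormal t 0) / 2⟩) :
    IsSpinor x a b := by
  have normal_binormal_eq (t : ℝ) : spinNormal (a t) (b t) = x.speed t • x.frame t ∧
      spinBinormal (a t) (b t) = x.speed t • x.binormal t := by
    refine spinNormal_and_spinBinormal_eq ?_ ?_ (ha t) ?_ ?_
    · simp only [real_inner_smul_left, real_inner_smul_right, x.frame_inner_self,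
        x.binormal_inner_self]
    · simp only [real_inner_smul_left, real_inner_smul_right, x.frame_inner_binormal, mul_zero]
    · simp [ha_sq t, mul_add, mul_sub]
    · simp [hab t]
  have speed_eq (t : ℝ) : spinSpeed (a t) (b t) = x.speed t := by
    rw [← norm_spinNormal, (normal_binormal_eq t).1, norm_smul, x.unit_frame, mul_one,
      Real.norm_of_nonneg (x.speed_pos t).le]
  refine ⟨fun t => smul_right_injective E3 (x.speed_pos t).ne' ?_, fun t => ?_⟩
  · dsimp only
    rw [← speed_eq, ← cross_spinNormal_spinBinormal, (normal_binormal_eq t).1,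
      (normal_binormal_eq t).2, speed_eq, cross_smul_smul, x.cross_frame_binormal,
      x.deriv_curve_eq, smul_smul]
  · rw [speed_eq, (normal_binormal_eq t).1]

theorem unitTangent_zero_eq_neg_one (x : FramedLoop ℓ) {t : ℝ}
    (h₁ : x.frame t 1 + x.binormal t 2 = 0) (h₂ : x.binormal t 1 - x.frame t 2 = 0) :
    unitTangent x.curve t 0 = -1 := by
  have binormal_one : x.binormal t 1 = x.frame t 2 := sub_eq_zero.1 h₂
  have binormal_two : x.binormal t 2 = -x.frame t 1 := eq_neg_of_add_eq_zero_right h₁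
  have frame_norm := x.frame_inner_self t
  have binormal_norm := x.binormal_inner_self t
  have orthogonal := x.frame_inner_binormal t
  rw [inner_eq_sum] at frame_norm
  rw [inner_eq_sum, binormal_one, binormal_two] at binormal_norm orthogonal
  have frame_zero : x.frame t 0 = 0 := by
    have : x.frame t 0 ^ 4 = 0 := by
      linear_combination x.frame t 0 ^ 2 * (frame_norm - binormal_norm) +
        x.frame t 0 * x.binormal t 0 * orthogonal
    exact pow_eq_zero_iff four_ne_zero |>.1 this
  rw [← x.cross_frame_binormal, cross_apply_zero, binormal_one, binormal_two]
  rw [frame_zero] at frame_norm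
  linarith

theorem exists_isSpinor_of_ne (x : FramedLoop ℓ) (h : ∀ t, unitTangent x.curve t 0 ≠ -1) :
    ∃ (σ : ℤˣ) (a b : LineSection σ), IsSpinor x a b := by
  have frame_contDiff := contDiff_euclidean.1 x.smooth_frame
  have binormal_contDiff := contDiff_euclidean.1 x.smooth_binormal
  have speed_contDiff : ContDiff ℝ ∞ x.speed := x.smooth_deriv.norm ℝ x.immersed
  have speed_periodic (t : ℝ) : x.speed (t + 2) = x.speed t := by
    rw [speed, deriv_periodic x.periodic_curve, speed]
  set f : ℝ → ℂ := fun t => ⟨x.speed t * (x.frame t 1 + x.binormal t 2) / 2,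
    x.speed t * (x.binormal t 1 - x.frame t 2) / 2⟩ with hf
  set w : ℝ → ℂ := fun t => ⟨-(x.speed t * x.frame t 0) / 2, -(x.speed t * x.binormal t 0) / 2⟩
    with hw
  have f_contDiff : ContDiff ℝ ∞ f := contDiff_complex_mk
    ((speed_contDiff.mul ((frame_contDiff 1).add (binormal_contDiff 2))).div_const 2)
    ((speed_contDiff.mul ((binormal_contDiff 1).sub (frame_contDiff 2))).div_const 2)
  have w_contDiff : ContDiff ℝ ∞ w := contDiff_complex_mk
    ((speed_contDiff.mul (frame_contDiff 0)).neg.div_const 2)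
    ((speed_contDiff.mul (binormal_contDiff 0)).neg.div_const 2)
  have f_ne_zero (t : ℝ) : f t ≠ 0 := fun h0 => h t <| by
    simp only [hf, Complex.ext_iff, zero_re, zero_im, div_eq_zero_iff, mul_eq_zero,
      (x.speed_pos t).ne', false_or, two_ne_zero, or_false] at h0
    exact x.unitTangent_zero_eq_neg_one h0.1 h0.2
  have f_periodic : Function.Periodic f 2 := fun t => by
    simp only [hf, speed_periodic t, x.periodic_frame t, x.periodic_binormal t]
  have w_periodic : Function.Periodic w 2 := fun t => by
    simp only [hw, speed_periodic t, x.periodic_frame t, x.periodic_binormal t]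
  obtain ⟨σ, a, ha_sq⟩ := exists_lineSection_sq_eq f_contDiff f_ne_zero f_periodic
  have a_ne_zero (t : ℝ) : a t ≠ 0 := fun h0 => f_ne_zero t (by simp [← ha_sq, h0])
  obtain ⟨b, hb⟩ := a.exists_mul_eq a_ne_zero w_contDiff w_periodic
  exact ⟨σ, a, b, x.isSpinor_of_mul_eq a_ne_zero ha_sq hb⟩

/-- The image of a framed loop under a rotation. -/
def rotate (x : FramedLoop ℓ) (R : E3 ≃ₗᵢ[ℝ] E3) : FramedLoop ℓ where
  curve t := R (x.curve t)
  frame t := R (x.frame t)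
  smooth_curve := R.contDiff.comp x.smooth_curve
  smooth_frame := R.contDiff.comp x.smooth_frame
  periodic_curve t := congrArg R (x.periodic_curve t)
  periodic_frame t := congrArg R (x.periodic_frame t)
  immersed t := by
    rw [deriv_map', ← norm_ne_zero_iff, R.norm_map]
    exact (x.speed_pos t).ne'
  unit_frame t := by rw [R.norm_map, x.unit_frame]
  normal_frame t := by rw [deriv_map', R.inner_map_map, x.normal_frame]
  length_eq := by simpa only [length, deriv_map', R.norm_map] using x.length_eq

theorem congruent_rotate (x : FramedLoop ℓ) {R : E3 ≃ₗᵢ[ℝ] E3}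
    (hR : LinearMap.det (R.toLinearEquiv : E3 →ₗ[ℝ] E3) = 1) : Congruent x (x.rotate R) :=
  ⟨R, 0, 0, hR, fun t => by simp [rotate], fun t => by simp [rotate, twistFrame]⟩

theorem unitTangent_rotate (x : FramedLoop ℓ) (R : E3 ≃ₗᵢ[ℝ] E3) (t : ℝ) :
    unitTangent (x.rotate R).curve t = R (unitTangent x.curve t) := by
  rw [← unitTangent_map R x.curve 0 t]
  simp only [add_zero]
  rfl

end FramedLoop

theorem det_reflection_span_singleton {u : E3} (hu : u ≠ 0) :
    LinearMap.det ((ℝ ∙ u).reflection.toLinearEquiv : E3 →ₗ[ℝ] E3) = 1 := by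
  have : Fact (Module.finrank ℝ E3 = 2 + 1) := ⟨by simp⟩
  exact (ℝ ∙ u).det_reflection.trans (by
    rw [Submodule.finrank_orthogonal_span_singleton (n := 2) hu, neg_one_sq])

theorem exists_rotation_map_eq {u v : E3} (norm_eq : ‖u‖ = ‖v‖) (huv : u + v ≠ 0) :
    ∃ R : E3 ≃ₗᵢ[ℝ] E3, LinearMap.det (R.toLinearEquiv : E3 →ₗ[ℝ] E3) = 1 ∧ R u = v := by
  refine ⟨(ℝ ∙ (u + v)).reflection, det_reflection_span_singleton huv, ?_⟩
  have := Submodule.reflection_sub (v := u) (w := -v) (by rwa [norm_neg])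
  rwa [sub_neg_eq_add, Submodule.reflection_orthogonal_apply, neg_inj] at this

namespace FramedLoop

variable {ℓ : ℝ}

theorem exists_forall_smul_unitTangent_ne (x : FramedLoop ℓ) :
    ∃ w : E3, 0 < w 0 ∧ ∀ r t : ℝ, r • unitTangent x.curve t ≠ w := by
  have cone_contDiff : ContDiff ℝ 1 fun p : ℝ × ℝ => p.1 • unitTangent x.curve p.2 :=
    contDiff_fst.smul ((x.smooth_unitTangent.of_le (by exact_mod_cast le_top)).comp contDiff_snd)
  have isOpen_halfSpace : IsOpen {w : E3 | 0 < w 0} := isOpen_lt continuous_const (by fun_prop)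
  obtain ⟨w, hw_pos, hw⟩ :=
    (cone_contDiff.dense_compl_range_of_finrank_lt_finrank (by simp)).inter_open_nonempty _
      isOpen_halfSpace ⟨!₂[1, 0, 0], by simp⟩
  exact ⟨w, hw_pos, fun r t h => hw ⟨(r, t), h⟩⟩

theorem exists_congruent_isSpinor (x : FramedLoop ℓ) :
    ∃ (y : FramedLoop ℓ) (σ : ℤˣ) (a b : LineSection σ), Congruent x y ∧ IsSpinor y a b := by
  obtain ⟨w, hw_pos, hw⟩ := x.exists_forall_smul_unitTangent_ne
  set e : E3 := EuclideanSpace.single 0 1 with he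
  have norm_e : ‖e‖ = 1 := by simp [he]
  obtain ⟨R, hR, hRw⟩ := exists_rotation_map_eq (u := w) (v := ‖w‖ • e)
    (by simp [norm_smul, norm_e]) fun h => by
      have := congrArg (fun u : E3 => u 0) h
      simp [he] at this
      linarith [norm_nonneg w]
  obtain ⟨σ, a, b, hab⟩ := (x.rotate R).exists_isSpinor_of_ne fun t ht => by
    rw [x.unitTangent_rotate] at ht
    have image_eq : e = -R (unitTangent x.curve t) := by
      rw [← inner_eq_neg_one_iff_of_norm_eq_one (𝕜 := ℝ) norm_e (by
        rw [R.norm_map, norm_eq_sqrt_real_inner, x.unitTangent_inner_self, Real.sqrt_one]), he,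
        EuclideanSpace.inner_single_left, ht]
      simp
    refine hw (-‖w‖) t (R.injective ?_)
    rw [hRw, image_eq, map_smul, smul_neg, neg_smul]
  exact ⟨_, σ, a, b, x.congruent_rotate hR, hab⟩

end FramedLoop

/-! ### The Euler–Lagrange equation of critical spinors -/

/-- A closed spinor field at which the Dirichlet energy is stationary with respect to all smooth
variations through closed spinor fields. -/
structure IsCriticalSpinor {σ : ℤˣ} (ℓ : ℝ) (a b : LineSection σ) : Prop extends
    IsClosedSpinor ℓ a b where
  hasDerivAt_dirichletEnergy : ∀ A B : ℝ → LineSection σ,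
    (ContDiff ℝ ∞ fun p : ℝ × ℝ => A p.1 p.2) → (ContDiff ℝ ∞ fun p : ℝ × ℝ => B p.1 p.2) →
    (∀ ε, IsClosedSpinor ℓ (A ε) (B ε)) → A 0 = a → B 0 = b →
    HasDerivAt (fun ε => dirichletEnergy (A ε) (B ε)) 0 0

section

variable {ℓ : ℝ} {σ : ℤˣ} {a b : LineSection σ}

theorem IsSpinor.isCriticalSpinor {x : FramedLoop ℓ} (h : IsSpinor x a b)
    (hx : IsCriticalPoint x.toModuli) : IsCriticalSpinor ℓ a b where
  toIsClosedSpinor := h.isClosedSpinor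
  hasDerivAt_dirichletEnergy A B hA hB hclosed hA0 hB0 := by
    have starts_at_x : Congruent (hclosed 0).toFramedLoop x :=
      (hclosed 0).isSpinor_toFramedLoop.congruent (by rwa [hA0, hB0])
    have energy_critical := (hx _ (IsClosedSpinor.isSmoothFamily hclosed hA hB)
      (Quotient.sound (s := congruenceSetoid ℓ) starts_at_x)).const_mul (4 : ℝ)⁻¹
    rw [mul_zero] at energy_critical
    refine energy_critical.congr_of_eventuallyEq (.of_forall fun ε => ?_)
    exact ((inv_mul_eq_iff_eq_mul₀ four_ne_zero).2
      (hclosed ε).isSpinor_toFramedLoop.energy_eq).symm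

theorem eventually_forall_spinSpeed_ne_zero {A B : ℝ → LineSection σ}
    (hA : Continuous fun p : ℝ × ℝ => A p.1 p.2) (hB : Continuous fun p : ℝ × ℝ => B p.1 p.2)
    {ε₀ : ℝ} (h : ∀ t, spinSpeed (A ε₀ t) (B ε₀ t) ≠ 0) :
    ∀ᶠ ε in nhds ε₀, ∀ t, spinSpeed (A ε t) (B ε t) ≠ 0 := by
  have speed_continuous : Continuous fun p : ℝ × ℝ => spinSpeed (A p.1 p.2) (B p.1 p.2) :=
    (continuous_normSq.comp hA).add (continuous_normSq.comp hB)
  have on_period : ∀ᶠ ε in nhds ε₀, ∀ t ∈ Set.Icc (0 : ℝ) 2, spinSpeed (A ε t) (B ε t) ≠ 0 :=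
    isCompact_Icc.eventually_forall_of_forall_eventually fun t _ =>
      speed_continuous.continuousAt.eventually_ne (h t)
  filter_upwards [on_period] with ε hε t
  have speed_periodic : Function.Periodic (fun t => spinSpeed (A ε t) (B ε t)) 2 := fun t => by
    simp only [LineSection.add_two, spinSpeed_unit_smul]
  obtain ⟨s, hs, hst⟩ := speed_periodic.exists_mem_Ico₀ two_pos t
  exact hst ▸ hε s (Set.Ico_subset_Icc_self hs)

theorem norm_sq_smul_add_smul {E : Type*} [SeminormedAddCommGroup E] [InnerProductSpace ℂ E]
    (c s : ℝ) (u v : E) :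
    ‖(c : ℂ) • u + (s : ℂ) • v‖ ^ 2
      = c ^ 2 * ‖u‖ ^ 2 + 2 * (c * s) * (⟪u, v⟫_ℂ).re + s ^ 2 * ‖v‖ ^ 2 := by
  rw [norm_add_sq (𝕜 := ℂ), inner_smul_left, inner_smul_right, norm_smul, norm_smul]
  simp [mul_pow]
  ring

theorem hasDerivAt_norm_sq_cos_add_sin {E : Type*} [SeminormedAddCommGroup E]
    [InnerProductSpace ℂ E] (u v : E) :
    HasDerivAt (fun θ : ℝ => ‖(Real.cos θ : ℂ) • u + (Real.sin θ : ℂ) • v‖ ^ 2)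
      (2 * (⟪u, v⟫_ℂ).re) 0 := by
  simp only [norm_sq_smul_add_smul]
  have hc := Real.hasDerivAt_cos 0
  have hs := Real.hasDerivAt_sin 0
  have h := (((hc.fun_pow 2).mul_const (‖u‖ ^ 2)).fun_add
    (((hc.fun_mul hs).const_mul 2).mul_const (⟪u, v⟫_ℂ).re)).fun_add
    ((hs.fun_pow 2).mul_const (‖v‖ ^ 2))
  simpa using h

namespace IsCriticalSpinor

theorem swap (h : IsCriticalSpinor ℓ a b) : IsCriticalSpinor ℓ b a where
  toIsClosedSpinor := h.toIsClosedSpinor.swap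
  hasDerivAt_dirichletEnergy A B hA hB hclosed hA0 hB0 := by
    simpa only [dirichletEnergy_comm] using
      h.hasDerivAt_dirichletEnergy B A hB hA (fun ε => (hclosed ε).swap) hB0 hA0

theorem eq_zero_of_hasDerivAt (h : IsCriticalSpinor ℓ a b) {A B : ℝ → LineSection σ}
    (hA : ContDiff ℝ ∞ fun p : ℝ × ℝ => A p.1 p.2) (hB : ContDiff ℝ ∞ fun p : ℝ × ℝ => B p.1 p.2)
    (hclosed : ∀ᶠ ε in nhds 0, IsClosedSpinor ℓ (A ε) (B ε)) (hA0 : A 0 = a) (hB0 : B 0 = b)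
    {d : ℝ} (hd : HasDerivAt (fun ε => dirichletEnergy (A ε) (B ε)) d 0) : d = 0 := by
  obtain ⟨δ, hδ, hball⟩ := Metric.eventually_nhds_iff.1 hclosed
  -- The reparametrization `ε ↦ (δ / 2) sin ε` keeps the variation inside the ball for all `ε`.
  have smooth_reparam : ContDiff ℝ ∞ fun p : ℝ × ℝ => (δ / 2 * Real.sin p.1, p.2) := by fun_prop
  have reparam_mem (ε : ℝ) : dist (δ / 2 * Real.sin ε) 0 < δ := by
    rw [dist_zero_right, norm_mul, Real.norm_of_nonneg (half_pos hδ).le]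
    exact (mul_le_of_le_one_right (half_pos hδ).le (Real.abs_sin_le_one ε)).trans_lt
      (half_lt_self hδ)
  have stationary := h.hasDerivAt_dirichletEnergy (fun ε => A (δ / 2 * Real.sin ε))
    (fun ε => B (δ / 2 * Real.sin ε)) (hA.comp smooth_reparam)
    (hB.comp smooth_reparam) (fun ε => hball (reparam_mem ε)) (by simpa using hA0)
    (by simpa using hB0)
  have reparam_deriv : HasDerivAt (fun ε => δ / 2 * Real.sin ε) (δ / 2) 0 := by
    simpa using (Real.hasDerivAt_sin 0).const_mul (δ / 2)
  have chain_rule := HasDerivAt.comp (0 : ℝ) (h := fun ε => δ / 2 * Real.sin ε)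
    (by simpa using hd) reparam_deriv
  exact (mul_eq_zero.1 (chain_rule.unique stationary)).resolve_right (half_pos hδ).ne'

theorem re_inner_derivative_eq_zero (h : IsCriticalSpinor ℓ a b) {α : LineSection σ}
    (hα : ‖α‖ = ‖a‖) (haα : ⟪a, α⟫_ℂ = 0) (hαb : ⟪α, b⟫_ℂ = 0) :
    (⟪LineSection.derivative σ a, LineSection.derivative σ α⟫_ℂ).re = 0 := by
  let A : ℝ → LineSection σ := fun θ => (Real.cos θ : ℂ) • a + (Real.sin θ : ℂ) • α
  have A_zero : A 0 = a := by simp [A]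
  have smooth_A : ContDiff ℝ ∞ fun p : ℝ × ℝ => A p.1 p.2 :=
    ((ofRealCLM.contDiff.comp (Real.contDiff_cos.comp contDiff_fst)).mul
      (a.contDiff.comp contDiff_snd)).add
    ((ofRealCLM.contDiff.comp (Real.contDiff_sin.comp contDiff_fst)).mul
      (α.contDiff.comp contDiff_snd))
  have smooth_b : ContDiff ℝ ∞ fun p : ℝ × ℝ => b p.2 := b.contDiff.comp contDiff_snd
  have closed : ∀ᶠ θ in nhds 0, IsClosedSpinor ℓ (A θ) b := by
    filter_upwards [eventually_forall_spinSpeed_ne_zero (A := A) (B := fun _ => b)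
      smooth_A.continuous smooth_b.continuous (A_zero ▸ h.ne_zero)] with θ hθ
    refine ⟨hθ, ?_, h.norm_sq_snd, ?_⟩
    · rw [norm_sq_smul_add_smul, haα, hα, ← h.norm_sq_fst, zero_re]
      linear_combination ‖a‖ ^ 2 * Real.cos_sq_add_sin_sq θ
    · rw [inner_add_left, inner_smul_left, inner_smul_left, h.inner_eq_zero, hαb]
      simp
  have energy_deriv : HasDerivAt (fun θ => dirichletEnergy (A θ) b)
      (2 * (⟪LineSection.derivative σ a, LineSection.derivative σ α⟫_ℂ).re) 0 := by
    simp only [dirichletEnergy, A, map_add, map_smul]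
    exact (hasDerivAt_norm_sq_cos_add_sin _ _).add_const _
  simpa using h.eq_zero_of_hasDerivAt smooth_A smooth_b closed A_zero rfl energy_deriv

theorem inner_derivative_derivative_eq_zero (h : IsCriticalSpinor ℓ a b) {α : LineSection σ}
    (haα : ⟪a, α⟫_ℂ = 0) (hbα : ⟪b, α⟫_ℂ = 0) :
    ⟪LineSection.derivative σ (LineSection.derivative σ a), α⟫_ℂ = 0 := by
  obtain rfl | hα := eq_or_ne α 0
  · exact inner_zero_right _
  have re_eq_zero (c : ℂ) (hc : ‖c • α‖ = ‖a‖) :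
      (c * ⟪LineSection.derivative σ a, LineSection.derivative σ α⟫_ℂ).re = 0 := by
    rw [← inner_smul_right, ← map_smul]
    exact h.re_inner_derivative_eq_zero hc (by rw [inner_smul_right, haα, mul_zero])
      (by rw [inner_smul_left, inner_eq_zero_symm.1 hbα, mul_zero])
  have norm_ratio : ‖a‖ / ‖α‖ * ‖α‖ = ‖a‖ := div_mul_cancel₀ _ (norm_ne_zero_iff.2 hα)
  have ratio_ne_zero : ‖a‖ / ‖α‖ ≠ 0 :=
    div_ne_zero (norm_ne_zero_iff.2 h.fst_ne_zero) (norm_ne_zero_iff.2 hα)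
  have re_part := re_eq_zero ((‖a‖ / ‖α‖ : ℝ) : ℂ) (by simpa [norm_smul] using norm_ratio)
  have im_part := re_eq_zero ((‖a‖ / ‖α‖ : ℝ) * I) (by simpa [norm_smul] using norm_ratio)
  rw [re_ofReal_mul] at re_part
  rw [mul_assoc, re_ofReal_mul, I_mul_re] at im_part
  rw [LineSection.inner_derivative_left, neg_eq_zero]
  exact Complex.ext ((mul_eq_zero.1 re_part).resolve_left ratio_ne_zero)
    (neg_eq_zero.1 ((mul_eq_zero.1 im_part).resolve_left ratio_ne_zero))

theorem derivative_derivative_mem_span (h : IsCriticalSpinor ℓ a b) :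
    LineSection.derivative σ (LineSection.derivative σ a) ∈ Submodule.span ℂ {a, b} := by
  have : FiniteDimensional ℂ (Submodule.span ℂ {a, b}) :=
    FiniteDimensional.span_of_finite ℂ (Set.toFinite _)
  rw [← (Submodule.span ℂ {a, b}).orthogonal_orthogonal, Submodule.mem_orthogonal']
  intro α hα
  rw [Submodule.mem_orthogonal] at hα
  exact h.inner_derivative_derivative_eq_zero (hα a (Submodule.subset_span (by simp)))
    (hα b (Submodule.subset_span (by simp)))

end IsCriticalSpinor

end

/-! ### The spectrum of a critical spinor -/

section SkewAdjoint

variable {E : Type*} [NormedAddCommGroup E] [InnerProductSpace ℂ E] {D : E →ₗ[ℂ] E}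

theorem inner_map_map_of_skew (hD : ∀ u v, ⟪D u, v⟫_ℂ = -⟪u, D v⟫_ℂ) (u v : E) :
    ⟪u, -D (D v)⟫_ℂ = ⟪D u, D v⟫_ℂ := by
  rw [inner_neg_right, hD]

/-- The sum in question is the trace of the symmetric operator `-D²` on the span of `e`. -/
theorem exists_eigenvectors_and_sum_norm_sq_eq (hD : ∀ u v, ⟪D u, v⟫_ℂ = -⟪u, D v⟫_ℂ) {n : ℕ}
    {e : Fin n → E} (he : Orthonormal ℂ e)
    (hspan : ∀ i, D (D (e i)) ∈ Submodule.span ℂ (Set.range e)) :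
    ∃ (f : Fin n → E) (μ : Fin n → ℝ), (∀ i, f i ≠ 0) ∧
      (∀ i, D (D (f i)) = -((μ i : ℂ) • f i)) ∧ ∑ i, ‖D (e i)‖ ^ 2 = ∑ i, μ i := by
  set K := Submodule.span ℂ (Set.range e)
  let basis : Module.Basis (Fin n) ℂ K := Module.Basis.span he.linearIndependent
  have basis_apply (i : Fin n) : (basis i : E) = e i :=
    congrArg Subtype.val (Module.Basis.span_apply he.linearIndependent i)
  have basis_orthonormal : Orthonormal ℂ basis := by
    rw [← K.subtypeₗᵢ.orthonormal_comp_iff]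
    convert he using 1
    exact funext basis_apply
  have finrank_eq : Module.finrank ℂ K = n := by
    rw [Module.finrank_eq_card_basis basis, Fintype.card_fin]
  have : FiniteDimensional ℂ K := Module.Basis.finiteDimensional_of_finite basis
  have K_stable : ∀ v ∈ K, (-(D ∘ₗ D)) v ∈ K :=
    (Submodule.span_le (p := K.comap (-(D ∘ₗ D)))).2
      (Set.range_subset_iff.2 fun i => K.neg_mem (hspan i))
  let T : K →ₗ[ℂ] K := (-(D ∘ₗ D)).restrict K_stable
  have inner_T (u v : K) : ⟪u, T v⟫_ℂ = ⟪D u, D v⟫_ℂ := inner_map_map_of_skew hD u v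
  have T_symmetric : T.IsSymmetric := fun u v => by
    rw [inner_T, ← inner_conj_symm, inner_T, inner_conj_symm]
  refine ⟨fun i => T_symmetric.eigenvectorBasis finrank_eq i, T_symmetric.eigenvalues finrank_eq,
    fun i => ?_, fun i => ?_, ?_⟩
  · exact Submodule.coe_eq_zero.not.2
      ((T_symmetric.eigenvectorBasis finrank_eq).orthonormal.ne_zero i)
  · exact neg_eq_iff_eq_neg.1
      (congrArg Subtype.val (T_symmetric.apply_eigenvectorBasis finrank_eq i))
  · have trace_eq := T_symmetric.trace_eq_sum_eigenvalues finrank_eq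
    rw [T.trace_eq_sum_inner (basis.toOrthonormalBasis basis_orthonormal)] at trace_eq
    simp only [Module.Basis.coe_toOrthonormalBasis, inner_T, basis_apply,
      inner_self_eq_norm_sq_to_K] at trace_eq
    exact_mod_cast trace_eq

theorem exists_eigenvectors_and_sum_norm_sq_eq_mul (hD : ∀ u v, ⟪D u, v⟫_ℂ = -⟪u, D v⟫_ℂ) {n : ℕ}
    {e : Fin n → E} {R : ℝ} (hR : 0 < R) (norm_sq_eq : ∀ i, ‖e i‖ ^ 2 = R)
    (orthogonal : Pairwise fun i j => ⟪e i, e j⟫_ℂ = 0)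
    (hspan : ∀ i, D (D (e i)) ∈ Submodule.span ℂ (Set.range e)) :
    ∃ (f : Fin n → E) (μ : Fin n → ℝ), (∀ i, f i ≠ 0) ∧
      (∀ i, D (D (f i)) = -((μ i : ℂ) • f i)) ∧ ∑ i, ‖D (e i)‖ ^ 2 = R * ∑ i, μ i := by
  let r : ℂ := ((Real.sqrt R)⁻¹ : ℝ)
  have norm_r_smul_sq (u : E) : ‖r • u‖ ^ 2 = R⁻¹ * ‖u‖ ^ 2 := by
    rw [norm_smul, mul_pow, norm_real, Real.norm_eq_abs, sq_abs, inv_pow, Real.sq_sqrt hR.le]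
  have r_ne_zero : r ≠ 0 := ofReal_ne_zero.2 (inv_ne_zero (Real.sqrt_pos.2 hR).ne')
  have normalized : Orthonormal ℂ fun i => r • e i := by
    refine ⟨fun i => ?_, fun i j hij => ?_⟩
    · rw [← sq_eq_sq₀ (norm_nonneg _) zero_le_one, norm_r_smul_sq, norm_sq_eq,
        inv_mul_cancel₀ hR.ne', one_pow]
    · dsimp only
      rw [inner_smul_left, inner_smul_right, orthogonal hij, mul_zero, mul_zero]
  have mem_span (i : Fin n) : e i ∈ Submodule.span ℂ (Set.range fun i => r • e i) := by
    rw [← inv_smul_smul₀ r_ne_zero (e i)]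
    exact Submodule.smul_mem _ _ (Submodule.subset_span ⟨i, rfl⟩)
  obtain ⟨f, μ, f_ne_zero, eigen, energy_eq⟩ := exists_eigenvectors_and_sum_norm_sq_eq hD normalized
    fun i => by
      rw [map_smul, map_smul]
      exact Submodule.smul_mem _ _
        (Submodule.span_le.2 (Set.range_subset_iff.2 mem_span) (hspan i))
  refine ⟨f, μ, f_ne_zero, eigen, ?_⟩
  simp only [map_smul, norm_r_smul_sq, ← Finset.mul_sum] at energy_eq
  rw [← energy_eq, mul_inv_cancel_left₀ hR.ne']

end SkewAdjoint

theorem exp_int_mul_pi_mul_I (c : ℤ) : exp (c * (Real.pi * I)) = ((c.negOnePow : ℤ) : ℂ) := by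
  rw [exp_int_mul, exp_pi_mul_I]
  rcases Int.even_or_odd c with hc | hc
  · simp [hc.neg_one_zpow, Int.negOnePow_even c hc]
  · simp [hc.neg_one_zpow, Int.negOnePow_odd c hc]

namespace LineSection

variable {σ : ℤˣ} {g : LineSection σ}

theorem eq_exp_mul_of_derivative_eq {z : ℂ} (h : derivative σ g = z • g) (t : ℝ) :
    g t = exp (z * t) * g 0 := by
  have solution_deriv (s : ℝ) : HasDerivAt (fun s : ℝ => exp (-(z * s)) * g s) 0 s := by
    have exponent_deriv : HasDerivAt (fun s : ℝ => -(z * s)) (-(z * 1)) s :=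
      ((hasDerivAt_id s).ofReal_comp.const_mul z).neg
    refine (exponent_deriv.cexp.mul (g.hasDerivAt s)).congr_deriv ?_
    rw [h, smul_apply]
    ring
  have solution_const := is_const_of_deriv_eq_zero (fun s => (solution_deriv s).differentiableAt)
    (fun s => (solution_deriv s).deriv) t 0
  have h0 : exp (-(z * t)) * g t = g 0 := by simpa using solution_const
  rw [← h0, ← mul_assoc, ← exp_add, add_neg_cancel, exp_zero, one_mul]

theorem eq_apply_zero_of_derivative_eq_zero (h : derivative σ g = 0) (t : ℝ) : g t = g 0 := by
  simpa using eq_exp_mul_of_derivative_eq (z := 0) (by rw [h, zero_smul]) t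

theorem exists_int_of_derivative_eq {z : ℝ} (hg : g ≠ 0) (h : derivative σ g = (z * I) • g) :
    ∃ c : ℤ, σ = c.negOnePow ∧ z = Real.pi * c / 2 := by
  have g_zero_ne_zero : g 0 ≠ 0 := fun h0 => hg <| ext fun t => by
    rw [eq_exp_mul_of_derivative_eq h, h0, mul_zero, zero_apply]
  have monodromy : exp (z * I * 2) = ((σ : ℤ) : ℂ) := by
    refine mul_right_cancel₀ g_zero_ne_zero ?_
    have h2 := eq_exp_mul_of_derivative_eq h (0 + 2)
    rw [add_two, Units.smul_def, zsmul_eq_mul] at h2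
    simpa using h2.symm
  have monodromy_sq : exp (z * I * 4) = 1 := by
    rw [show (z * I * 4 : ℂ) = z * I * 2 + z * I * 2 by ring, exp_add, monodromy]
    rcases Int.units_eq_one_or σ with rfl | rfl <;> simp
  obtain ⟨c, hc⟩ := exp_eq_one_iff.1 monodromy_sq
  have hz : (z : ℂ) = Real.pi * c / 2 := mul_right_cancel₀ I_ne_zero (by linear_combination hc / 4)
  refine ⟨c, Units.ext ?_, by exact_mod_cast hz⟩
  rw [show (z * I * 2 : ℂ) = c * (Real.pi * I) by rw [hz]; ring, exp_int_mul_pi_mul_I] at monodromy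
  exact_mod_cast monodromy.symm

theorem exists_int_of_derivative_derivative_eq {μ : ℝ} (hg : g ≠ 0)
    (h : derivative σ (derivative σ g) = -((μ : ℂ) • g)) :
    ∃ c : ℤ, σ = c.negOnePow ∧ μ = (Real.pi * c / 2) ^ 2 := by
  have rayleigh : μ * ‖g‖ ^ 2 = ‖derivative σ g‖ ^ 2 := by
    have inner_eq := inner_derivative_left g (derivative σ g)
    rw [h, inner_neg_right, inner_smul_right, neg_neg, inner_self_eq_norm_sq_to_K,
      inner_self_eq_norm_sq_to_K] at inner_eq
    refine ofReal_injective ?_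
    push_cast
    exact inner_eq.symm
  have μ_nonneg : 0 ≤ μ :=
    nonneg_of_mul_nonneg_left (rayleigh ▸ sq_nonneg _) (pow_pos (norm_pos_iff.2 hg) 2)
  have sqrt_sq : (Real.sqrt μ : ℂ) * Real.sqrt μ = μ := by
    exact_mod_cast Real.mul_self_sqrt μ_nonneg
  -- `d² + μ = (d - i√μ)(d + i√μ)`, and one of the two factors has a kernel.
  by_cases hf : derivative σ g + (Real.sqrt μ * I) • g = 0
  · obtain ⟨c, hc, hz⟩ := exists_int_of_derivative_eq (z := -Real.sqrt μ) hg (by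
      rw [eq_neg_of_add_eq_zero_left hf, ← neg_smul]
      push_cast
      ring_nf)
    exact ⟨c, hc, by rw [← hz, neg_sq, Real.sq_sqrt μ_nonneg]⟩
  · obtain ⟨c, hc, hz⟩ := exists_int_of_derivative_eq (z := Real.sqrt μ) hf (by
      rw [map_add, map_smul, h, smul_add, smul_smul,
        show (Real.sqrt μ * I) * (Real.sqrt μ * I) = -(μ : ℂ) by
          linear_combination -sqrt_sq + Real.sqrt μ * Real.sqrt μ * I_mul_I, neg_smul, add_comm])
    exact ⟨c, hc, by rw [← hz, Real.sq_sqrt μ_nonneg]⟩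

end LineSection

section

variable {ℓ : ℝ} {σ : ℤˣ} {a b : LineSection σ}

theorem IsClosedSpinor.dirichletEnergy_pos (h : IsClosedSpinor ℓ a b) :
    0 < dirichletEnergy a b := by
  have energy_nonneg : 0 ≤ dirichletEnergy a b := add_nonneg (sq_nonneg _) (sq_nonneg _)
  refine energy_nonneg.lt_of_ne' fun energy_zero => h.fst_ne_zero ?_
  obtain ⟨norm_a, norm_b⟩ := (add_eq_zero_iff_of_nonneg (sq_nonneg _) (sq_nonneg _)).1 energy_zero
  have a_const := LineSection.eq_apply_zero_of_derivative_eq_zero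
    (norm_eq_zero.1 (sq_eq_zero_iff.1 norm_a))
  have b_const := LineSection.eq_apply_zero_of_derivative_eq_zero
    (norm_eq_zero.1 (sq_eq_zero_iff.1 norm_b))
  have proportional : b 0 • a = a 0 • b := LineSection.ext fun t => by
    rw [LineSection.smul_apply, LineSection.smul_apply, a_const t, b_const t, mul_comm]
  have inner_zero : b 0 * ⟪a, a⟫_ℂ = 0 := by
    rw [← inner_smul_right, proportional, inner_smul_right, h.inner_eq_zero, mul_zero]
  rcases mul_eq_zero.1 inner_zero with hb | ha
  · exact (h.swap.fst_ne_zero (LineSection.ext fun t => by rw [b_const, hb]; rfl)).elim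
  · exact inner_self_eq_zero.1 ha

theorem IsCriticalSpinor.exists_dirichletEnergy_eq (h : IsCriticalSpinor ℓ a b) :
    ∃ c d : ℤ, c ≡ d [ZMOD 2] ∧
      dirichletEnergy a b = ℓ * (Real.pi ^ 2 * ((c : ℝ) ^ 2 + (d : ℝ) ^ 2) / 8) := by
  have norm_sq_eq (i : Fin 2) : ‖![a, b] i‖ ^ 2 = ℓ / 2 := by
    fin_cases i
    exacts [h.norm_sq_fst, h.norm_sq_snd]
  have orthogonal : Pairwise fun i j => ⟪![a, b] i, ![a, b] j⟫_ℂ = 0 := by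
    intro i j hij
    fin_cases i <;> fin_cases j
    exacts [(hij rfl).elim, h.inner_eq_zero, h.swap.inner_eq_zero, (hij rfl).elim]
  have stable (i : Fin 2) : LineSection.derivative σ (LineSection.derivative σ (![a, b] i))
      ∈ Submodule.span ℂ (Set.range ![a, b]) := by
    rw [Matrix.range_cons_cons_empty]
    fin_cases i
    exacts [h.derivative_derivative_mem_span,
      Set.pair_comm b a ▸ h.swap.derivative_derivative_mem_span]
  obtain ⟨f, μ, f_ne_zero, eigen, energy_eq⟩ := exists_eigenvectors_and_sum_norm_sq_eq_mul
    LineSection.inner_derivative_left (half_pos h.length_pos) norm_sq_eq orthogonal stable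
  obtain ⟨c, hc, hμ₀⟩ := LineSection.exists_int_of_derivative_derivative_eq (f_ne_zero 0) (eigen 0)
  obtain ⟨d, hd, hμ₁⟩ := LineSection.exists_int_of_derivative_derivative_eq (f_ne_zero 1) (eigen 1)
  have hcd : Even (d - c) := (Int.negOnePow_eq_iff d c).1 (hd.symm.trans hc)
  refine ⟨c, d, (Int.modEq_iff_dvd.2 hcd.two_dvd), ?_⟩
  rw [Fin.sum_univ_two, Fin.sum_univ_two, hμ₀, hμ₁] at energy_eq
  refine energy_eq.trans ?_
  ring

end

theorem exists_int_of_mem_criticalEnergyLevels {ℓ e : ℝ} (he : e ∈ criticalEnergyLevels ℓ) :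
    ∃ c d : ℤ, c ≡ d [ZMOD 2] ∧ ¬ (c = 0 ∧ d = 0) ∧
      e = ℓ * (Real.pi ^ 2 * ((c : ℝ) ^ 2 + (d : ℝ) ^ 2) / 2) := by
  obtain ⟨m, hm, rfl⟩ := he
  obtain ⟨x, rfl⟩ := Quotient.exists_rep m
  obtain ⟨y, σ, a, b, hxy, hy⟩ := x.exists_congruent_isSpinor
  have same_point : x.toModuli = y.toModuli := Quotient.sound (s := congruenceSetoid ℓ) hxy
  have critical : IsCriticalSpinor ℓ a b := hy.isCriticalSpinor (same_point ▸ hm)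
  obtain ⟨c, d, hcd, dirichlet_eq⟩ := critical.exists_dirichletEnergy_eq
  refine ⟨c, d, hcd, ?_, ?_⟩
  · rintro ⟨rfl, rfl⟩
    exact critical.dirichletEnergy_pos.ne' (by simpa using dirichlet_eq)
  · calc moduliEnergy x.toModuli = energy x.curve x.frame := rfl
      _ = energy y.curve y.frame := hxy.energy_eq
      _ = 4 * dirichletEnergy a b := hy.energy_eq
      _ = ℓ * (Real.pi ^ 2 * ((c : ℝ) ^ 2 + (d : ℝ) ^ 2) / 2) := by rw [dirichlet_eq]; ring

/-! ### Twisted circles realizing the critical levels -/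

/-- The section `r exp (π i c t / 2)` of constant modulus, for an integer `c` whose parity is
prescribed by `σ`. -/
def fourierSection {σ : ℤˣ} {c : ℤ} (r : ℝ) (hc : σ = c.negOnePow) : LineSection σ :=
  ⟨fun t => r * exp (Real.pi * c / 2 * t * I), by
    exact contDiff_const.mul ((contDiff_const.mul ofRealCLM.contDiff).mul contDiff_const).cexp,
    fun t => by
      dsimp only
      rw [show (Real.pi * c / 2 * (t + 2 : ℝ) * I : ℂ)
        = Real.pi * c / 2 * t * I + c * (Real.pi * I) by push_cast; ring, exp_add,
        exp_int_mul_pi_mul_I, ← hc, Units.smul_def, zsmul_eq_mul]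
      ring⟩

section

variable {σ : ℤˣ} {c d : ℤ} {r : ℝ}

theorem fourierSection_apply (hc : σ = c.negOnePow) (t : ℝ) :
    fourierSection r hc t = r * exp (Real.pi * c / 2 * t * I) := rfl

theorem normSq_fourierSection (hc : σ = c.negOnePow) (t : ℝ) :
    normSq (fourierSection r hc t) = r ^ 2 := by
  rw [fourierSection_apply, normSq_eq_norm_sq, norm_mul, norm_real, Real.norm_eq_abs,
    show (Real.pi * c / 2 * t * I : ℂ) = (Real.pi * c / 2 * t : ℝ) * I by push_cast; rfl,
    norm_exp_ofReal_mul_I, mul_one, sq_abs]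

theorem norm_sq_fourierSection (hc : σ = c.negOnePow) : ‖fourierSection r hc‖ ^ 2 = 2 * r ^ 2 := by
  simp [LineSection.norm_sq_eq, normSq_fourierSection]

theorem derivative_fourierSection (hc : σ = c.negOnePow) :
    LineSection.derivative σ (fourierSection r hc)
      = (Real.pi * c / 2 * I : ℂ) • fourierSection r hc := by
  ext t
  have phase_deriv : HasDerivAt (fun t : ℝ => (Real.pi * c / 2 * t * I : ℂ))
      (Real.pi * c / 2 * 1 * I) t :=
    ((hasDerivAt_id t).ofReal_comp.const_mul _).mul_const I
  rw [((fourierSection r hc).hasDerivAt t).unique (phase_deriv.cexp.const_mul (r : ℂ)),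
    LineSection.smul_apply, fourierSection_apply]
  ring

theorem inner_fourierSection (hc : σ = c.negOnePow) (hd : σ = d.negOnePow) (hcd : c ≠ d) :
    ⟪fourierSection r hc, fourierSection r hd⟫_ℂ = 0 := by
  have skew := LineSection.inner_derivative_left (fourierSection r hc) (fourierSection r hd)
  rw [derivative_fourierSection, derivative_fourierSection, inner_smul_left, inner_smul_right]
    at skew
  have frequency_gap : (Real.pi * (d - c) / 2 * I : ℂ) ≠ 0 := by
    simp [sub_eq_zero, Real.pi_ne_zero, hcd.symm]
  refine (mul_eq_zero.1 (?_ : (Real.pi * (d - c) / 2 * I : ℂ) * _ = 0)).resolve_left frequency_gap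
  simp only [map_mul, map_div₀, conj_ofReal, conj_I, map_intCast, map_ofNat] at skew
  linear_combination skew

theorem conj_fourierSection_mul (hc : σ = c.negOnePow) (hd : σ = d.negOnePow) (t : ℝ) :
    conj (fourierSection r hc t) * fourierSection r hd t
      = (r ^ 2 : ℝ) * exp ((Real.pi * (d - c) / 2 * t : ℝ) * I) := by
  rw [fourierSection_apply, fourierSection_apply, map_mul, conj_ofReal, ← exp_conj,
    mul_mul_mul_comm, ← exp_add, ← ofReal_mul, ← sq]
  congr 2
  simp only [map_mul, map_div₀, conj_ofReal, conj_I, map_intCast, map_ofNat]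
  push_cast
  ring

theorem isClosedSpinor_fourierSection {ℓ : ℝ} (hr : 0 < r) (hℓ : 4 * r ^ 2 = ℓ)
    (hc : σ = c.negOnePow) (hd : σ = d.negOnePow) (hcd : c ≠ d) :
    IsClosedSpinor ℓ (fourierSection r hc) (fourierSection r hd) where
  ne_zero t := by
    rw [spinSpeed, normSq_fourierSection, normSq_fourierSection]
    positivity
  norm_sq_fst := by rw [norm_sq_fourierSection, ← hℓ]; ring
  norm_sq_snd := by rw [norm_sq_fourierSection, ← hℓ]; ring
  inner_eq_zero := inner_fourierSection hc hd hcd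

theorem spinSpeed_fourierSection (hc : σ = c.negOnePow) (hd : σ = d.negOnePow) (t : ℝ) :
    spinSpeed (fourierSection r hc t) (fourierSection r hd t) = 2 * r ^ 2 := by
  rw [spinSpeed, normSq_fourierSection, normSq_fourierSection, two_mul]

theorem spinTangent_fourierSection (hc : σ = c.negOnePow) (hd : σ = d.negOnePow) (t : ℝ) :
    spinTangent (fourierSection r hc t) (fourierSection r hd t)
      = (2 * r ^ 2) • !₂[0, Real.cos (Real.pi * (d - c) / 2 * t),
        Real.sin (Real.pi * (d - c) / 2 * t)] := by
  rw [spinTangent, normSq_fourierSection, normSq_fourierSection, conj_fourierSection_mul,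
    re_ofReal_mul, im_ofReal_mul, exp_ofReal_mul_I_re, exp_ofReal_mul_I_im]
  ext i
  fin_cases i <;> simp [mul_assoc]

theorem im_conj_mul_derivative_fourierSection (hc : σ = c.negOnePow) (t : ℝ) :
    (conj (fourierSection r hc t) * LineSection.derivative σ (fourierSection r hc) t).im
      = Real.pi * c / 2 * r ^ 2 := by
  rw [derivative_fourierSection, LineSection.smul_apply, mul_left_comm, ← normSq_eq_conj_mul_self,
    normSq_fourierSection,
    show (Real.pi * c / 2 * I * (r ^ 2 : ℝ) : ℂ) = (Real.pi * c / 2 * r ^ 2 : ℝ) * I by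
      push_cast; ring, im_ofReal_mul, I_im, mul_one]

theorem hasDerivAt_circle (k t : ℝ) :
    HasDerivAt (fun t => (!₂[0, Real.cos (k * t), Real.sin (k * t)] : E3))
      (k • !₂[0, -Real.sin (k * t), Real.cos (k * t)]) t := by
  have phase_deriv : HasDerivAt (fun t => k * t) k t := hasDerivAt_const_mul k
  refine (hasDerivAt_vec3 (hasDerivAt_const t 0) phase_deriv.cos phase_deriv.sin).congr_deriv ?_
  ext i
  fin_cases i <;> simp [mul_comm]

theorem deriv_deriv_circle (k t : ℝ) :
    deriv (deriv fun t => (!₂[0, Real.cos (k * t), Real.sin (k * t)] : E3)) t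
      = -(k ^ 2) • !₂[0, Real.cos (k * t), Real.sin (k * t)] := by
  have phase_deriv : HasDerivAt (fun t => k * t) k t := hasDerivAt_const_mul k
  rw [funext fun t => (hasDerivAt_circle k t).deriv]
  refine ((hasDerivAt_vec3 (hasDerivAt_const t 0) phase_deriv.sin.neg
    phase_deriv.cos).const_smul k).deriv.trans ?_
  ext i
  fin_cases i <;> simp <;> ring

theorem IsSpinor.isTwistedCircle {ℓ : ℝ} {x : FramedLoop ℓ} {hc : σ = c.negOnePow}
    {hd : σ = d.negOnePow} (hx : IsSpinor x (fourierSection r hc) (fourierSection r hd)) :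
    IsTwistedCircle x (Real.pi * (d - c) / 2) (-(Real.pi * (c + d) / 2)) := by
  have speed_eq (t : ℝ) : x.speed t = 2 * r ^ 2 := by
    rw [hx.speed, spinSpeed_fourierSection]
  have speed_ne_zero : 2 * r ^ 2 ≠ 0 := speed_eq 0 ▸ (x.speed_pos 0).ne'
  have length_eq : 2 * r ^ 2 = ℓ / 2 := norm_sq_fourierSection hc ▸ hx.isClosedSpinor.norm_sq_fst
  have tangent_eq : unitTangent x.curve = fun t => !₂[0, Real.cos (Real.pi * (d - c) / 2 * t),
      Real.sin (Real.pi * (d - c) / 2 * t)] := funext fun t => by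
    refine smul_right_injective E3 speed_ne_zero ?_
    dsimp only
    rw [← spinTangent_fourierSection hc hd, ← hx.tangent, x.deriv_curve_eq, speed_eq]
  refine ⟨fun t => (speed_eq t).trans length_eq, fun t => ?_,
    ⟨!₂[Real.pi * (d - c) / 2, 0, 0], fun t => ?_⟩, fun t => ?_⟩
  · rw [tangent_eq, deriv_deriv_circle]
  · rw [tangent_eq, (hasDerivAt_circle _ t).deriv]
    ext i
    fin_cases i
    · simp [cross_apply_zero]
      linear_combination Real.pi * (d - c) / 2 * Real.sin_sq_add_cos_sq (Real.pi * (d - c) / 2 * t)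
    · simp [cross_apply_one]
    · simp [cross_apply_two]
  · have twist_eq := hx.speed_mul_twist t
    rw [speed_eq, add_im, im_conj_mul_derivative_fourierSection,
      im_conj_mul_derivative_fourierSection] at twist_eq
    exact mul_left_cancel₀ speed_ne_zero (twist_eq.trans (by ring))

theorem mem_criticalEnergyLevels_of_ne {ℓ : ℝ} (hℓ : 0 < ℓ) (parity_eq : c.negOnePow = d.negOnePow)
    (hcd : c ≠ d) :
    ℓ * (Real.pi ^ 2 * ((c : ℝ) ^ 2 + (d : ℝ) ^ 2) / 2) ∈ criticalEnergyLevels ℓ := by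
  have modulus_sq : 4 * (Real.sqrt ℓ / 2) ^ 2 = ℓ := by
    rw [div_pow, Real.sq_sqrt hℓ.le]
    ring
  have spinor := isClosedSpinor_fourierSection (half_pos (Real.sqrt_pos.2 hℓ)) modulus_sq rfl
    parity_eq hcd
  convert spinor.isSpinor_toFramedLoop.isTwistedCircle.mem_criticalEnergyLevels using 1
  ring

end

theorem mem_criticalEnergyLevels {ℓ : ℝ} (hℓ : 0 < ℓ) {c d : ℤ} (hcd : c ≡ d [ZMOD 2])
    (h0 : ¬ (c = 0 ∧ d = 0)) :
    ℓ * (Real.pi ^ 2 * ((c : ℝ) ^ 2 + (d : ℝ) ^ 2) / 2) ∈ criticalEnergyLevels ℓ := by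
  have parity_eq : c.negOnePow = d.negOnePow :=
    (Int.negOnePow_eq_iff c d).2 (even_iff_two_dvd.2 hcd.symm.dvd)
  rcases ne_or_eq c d with hne | rfl
  · exact mem_criticalEnergyLevels_of_ne hℓ parity_eq hne
  · -- The frequencies `c, c` give no closed curve, but `c, -c` give the same energy.
    have hne : c ≠ -c := fun h => h0 (and_self_iff.2 (self_eq_neg.1 h))
    simpa using mem_criticalEnergyLevels_of_ne hℓ (Int.negOnePow_neg c).symm hne

end FramedCurve

end

theorem mainTheorem3 (ℓ : ℝ) (hℓ : 0 < ℓ) :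
    FramedCurve.criticalEnergyLevels ℓ =
      {e : ℝ | ∃ c d : ℤ, c ≡ d [ZMOD 2] ∧ ¬ (c = 0 ∧ d = 0) ∧
        e = ℓ * (Real.pi ^ 2 * ((c : ℝ) ^ 2 + (d : ℝ) ^ 2) / 2)} := by
  refine Set.Subset.antisymm
    (fun e he => FramedCurve.exists_int_of_mem_criticalEnergyLevels he) ?_
  rintro _ ⟨c, d, parity_eq, ne_zero, rfl⟩
  exact FramedCurve.mem_criticalEnergyLevels hℓ parity_eq ne_zero
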